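/- **Definitions.** Let $G$ be a group. A *metric simplicial tree* is the geometric realisation, with the path metric, of a simplicial tree in which every edge is given a positive length, such that the lengths of the edges at any given vertex are bounded away from $0$. A *$G$-tree* is a metric simplicial tree $T$ with an isometric right action of $G$; it carries a $G$-invariant simplicial structure on which $G$ acts without inversions (any such structure is allowed below; in particular the one with the fewest vertices). A *subforest* of $T$ is a subspace given by a set of vertices and a set of edges whose endpoints belong to that set of vertices; a *subtree* is a connected (non-empty) subforest; *proper* means not equal to $T$. The $G$-tree $T$ is *minimal* if it has no proper $G$-invariant subtree, *cocompact* if the graph $T/G$ is finite, and *edge-free* if every edge has trivial stabiliser. A subgroup of $G$ is *elliptic* in $T$ if it fixes a point of $T$. A *free factor system* for $G$ is the set $\mathcal G$ of elliptic subgroups of some minimal, cocompact, edge-free $G$-tree; it is *proper* if $G\notin\mathcal G$. The deformation space $\mathcal O=\mathcal O(G,\mathcal G)$ consists of the minimal, cocompact, edge-free $G$-trees whose set of elliptic subgroups is $\mathcal G$ (up to equivariant isometry). For an outer automorphism $\alpha$ of $G$, represented by an automorphism which is also written $\alpha$, a free factor system $\mathcal H$ is *$\alpha$-invariant* if $\{\alpha(H):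 H\in\mathcal H\}=\mathcal H$, and $\mathrm{Out}(G,\mathcal G)$ is the group of those $\alpha$ for which $\mathcal G$ is $\alpha$-invariant. If $\mathcal G$ is proper and $\alpha\in\mathrm{Out}(G,\mathcal G)$, then $\alpha$ is *irreducible with respect to $\mathcal G$* if $\mathcal G$ is maximal under inclusion among the proper $\alpha$-invariant free factor systems for $G$, and *reducible with respect to $\mathcal G$* otherwise. For $T\in\mathcal O$, $\alpha T$ denotes the same metric tree with the twisted action $x\cdot_\alpha g=x\cdot\alpha(g)$. A map $f:T\to\alpha T$ *topologically represents* $\alpha$ if it is $G$-equivariant, Lipschitz, and has constant speed on each edge; it is *simplicial* if it maps vertices to vertices. Such an $f$ induces a map $\varphi:T/G\to T/G$. A subspace $Y$ is *$f$-invariant* if $f(Y)\subseteq Y$, and similarly for $\varphi$. A subforest $F$ of $T$ is *$\mathcal G$-elliptic* if for every component $A$ of $F$ the setwise stabiliser $\{g\in G: A\cdot g=A\}$ belongs to $\mathcal G$, and *$\mathcal G$-hyperbolic* otherwise. Let $X$ be a quotient graph of groups on $T/G$: its vertex groups are the stabilisers of the vertices of a lift to $T$ of a maximal tree of $T/G$,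 and its edge groups are trivial, so that $\pi_1(X)\cong G$. A subgraph of $T/G$ is *$\mathcal G$-elliptic* if for each component of the corresponding subgraph-of-groups of $X$ the fundamental group, viewed as a subgroup of $G$ (well defined up to conjugation), belongs to $\mathcal G$, and *$\mathcal G$-hyperbolic* otherwise. **Theorem.** Let $\mathcal G$ be a proper free factor system for a group $G$, let $\alpha\in\mathrm{Out}(G,\mathcal G)$, and let $T\in\mathcal O(G,\mathcal G)$. Suppose that $\alpha$ is topologically represented by a simplicial map $f:T\to\alpha T$. 1. If there is a proper, $f$-invariant, $G$-invariant, $\mathcal G$-hyperbolic subforest of $T$, then $\alpha$ is reducible with respect to $\mathcal G$. 2. If there is a proper, $\varphi$-invariant, $\mathcal G$-hyperbolic subgraph of $T/G$, then $\alpha$ is reducible with respect to $\mathcal G$. -/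

import Mathlib

universe u

namespace FreeFactor

/-! ### Metric simplicial trees -/

/-- A metric simplicial tree, presented by a simplicial structure: a one-dimensional simplicial
complex which is a tree, with a length for every edge, such that the lengths of the edges at any
given vertex are bounded away from `0`. (Values of `len` off the edges are irrelevant.)
The metric space itself is `MetricTree.Point` with the path metric `MetricTree.dist`. -/
structure MetricTree where
  V : Type u
  graph : SimpleGraph V
  isTree : graph.IsTree
  len : Sym2 V → ℝ
  len_bound : ∀ v, ∃ ε > 0, ∀ w, graph.Adj v w → ε ≤ len s(v, w)

namespace MetricTree

variable (M : MetricTree.{u})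

open Classical in
/-- Barycentric coordinates of the point that divides the segment from `u` to `v` in the
ratio `t : 1 - t`. -/
noncomputable def bary {V : Type u} (u v : V) (t : ℝ) : V → ℝ :=
  fun w => (1 - t) * (if w = u then 1 else 0) + t * (if w = v then 1 else 0)

/-- The points of the geometric realisation, in barycentric coordinates: a point is a vertex or
lies on an edge. -/
def Point : Type u :=
  {x : M.V → ℝ // ∃ u v t, (u = v ∨ M.graph.Adj u v) ∧ 0 ≤ t ∧ t ≤ 1 ∧ x = bary u v t}

/-- A vertex, as a point of the realisation. -/
noncomputable def vertexPoint (v : M.V) : M.Point :=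
  ⟨bary v v 0, v, v, 0, Or.inl rfl, le_refl _, zero_le_one, rfl⟩

variable {M}

/-- The point `x` lies in the closed simplex spanned by `u` and `v`. -/
def OnEdge (x : M.Point) (u v : M.V) : Prop := ∀ w, x.1 w ≠ 0 → w = u ∨ w = v

/-- `PathLength x y ℓ`: there is a piecewise linear path of length `ℓ` from `x` to `y`, each
piece of which is a segment in a closed edge. -/
inductive PathLength : M.Point → M.Point → ℝ → Prop
  | refl (x : M.Point) : PathLength x x 0
  | step (x y z : M.Point) (u v : M.V) (ℓ : ℝ) (huv : M.graph.Adj u v)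
      (hx : OnEdge x u v) (hy : OnEdge y u v) (h : PathLength y z ℓ) :
      PathLength x z (M.len s(u, v) * |x.1 u - y.1 u| + ℓ)

/-- The path metric of the tree. -/
noncomputable def dist (x y : M.Point) : ℝ := sInf {ℓ | PathLength x y ℓ}

/-- The subspace of the realisation given by a subforest. A subforest is a set of vertices
together with a set of edges whose endpoints lie in that set of vertices, that is, a subgraph
of the underlying graph. -/
def carrier (F : M.graph.Subgraph) : Set M.Point :=
  {x | (∃ v ∈ F.verts, x = M.vertexPoint v) ∨ ∃ u v, F.Adj u v ∧ OnEdge x u v}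

/-- A map of trees is straight if it has constant speed on every edge. -/
def IsStraight {N : MetricTree.{u}} (f : M.Point → N.Point) : Prop :=
  ∀ u v, M.graph.Adj u v → ∃ c : ℝ, 0 ≤ c ∧
    ∀ x y : M.Point, OnEdge x u v → OnEdge y u v → dist (f x) (f y) = c * dist x y

/-- Lipschitz continuity for the path metrics. -/
def IsLipschitz {N : MetricTree.{u}} (f : M.Point → N.Point) : Prop :=
  ∃ C : ℝ, ∀ x y, dist (f x) (f y) ≤ C * dist x y

/-- A map of trees is simplicial if it maps vertices to vertices (edges need not be mapped
to edges). -/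
def IsSimplicial {N : MetricTree.{u}} (f : M.Point → N.Point) : Prop :=
  ∀ v, ∃ w, f (M.vertexPoint v) = N.vertexPoint w

end MetricTree

/-! ### `G`-trees -/

/-- A `G`-tree: a metric simplicial tree with an isometric right action of `G`, together with a
`G`-invariant simplicial structure on which `G` acts without inversions. The usual structure,
with the fewest vertices, is one such; no restriction on the structure is made here. -/
structure GTree (G : Type u) [Group G] extends MetricTree.{u} where
  act : V → G → V
  act_one : ∀ v, act v 1 = v
  act_mul : ∀ v g h, act v (g * h) = act (act v g) h
  act_adj : ∀ u v g, graph.Adj u v → graph.Adj (act u g) (act v g)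
  act_len : ∀ u v g, graph.Adj u v → len s(act u g, act v g) = len s(u, v)
  no_inversion : ∀ u v g, graph.Adj u v → ¬ (act u g = v ∧ act v g = u)

namespace GTree

variable {G : Type u} [Group G] (T : GTree G)

theorem act_inv_act (v : T.V) (g : G) : T.act (T.act v g⁻¹) g = v := by
  rw [← T.act_mul, inv_mul_cancel, T.act_one]

theorem act_act_inv (v : T.V) (g : G) : T.act (T.act v g) g⁻¹ = v := by
  rw [← T.act_mul, mul_inv_cancel, T.act_one]

theorem act_inv_eq_iff (w u : T.V) (g : G) : T.act w g⁻¹ = u ↔ w = T.act u g :=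
  ⟨fun h => by rw [← h, act_inv_act], fun h => by rw [h, act_act_inv]⟩

/-- The action on the points of the tree: the linear extension of the action on vertices. -/
def actPoint (x : T.Point) (g : G) : T.Point :=
  ⟨fun w => x.1 (T.act w g⁻¹), by
    obtain ⟨u, v, t, h, h0, h1, hx⟩ := x.2
    refine ⟨T.act u g, T.act v g, t, h.imp (fun e => by rw [e]) (T.act_adj u v g), h0, h1, ?_⟩
    funext w
    simp only [hx, MetricTree.bary]
    classical
    exact congrArg₂ (fun p q => (1 - t) * p + t * q)
      (if_congr (T.act_inv_eq_iff w u g) rfl rfl) (if_congr (T.act_inv_eq_iff w v g) rfl rfl)⟩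

/-- The subgroup `H` is elliptic: it fixes a point of the tree. -/
def IsElliptic (H : Subgroup G) : Prop := ∃ x : T.Point, ∀ h ∈ H, T.actPoint x h = x

/-- The set of elliptic subgroups. -/
def ellipticSubgroups : Set (Subgroup G) := {H | T.IsElliptic H}

/-- A subforest is `G`-invariant. -/
def Invariant (F : T.graph.Subgraph) : Prop :=
  (∀ v ∈ F.verts, ∀ g, T.act v g ∈ F.verts) ∧
    ∀ u v, F.Adj u v → ∀ g, F.Adj (T.act u g) (T.act v g)

/-- There is no proper `G`-invariant subtree (a subtree is a connected, in particular non-empty,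
subforest). -/
def IsMinimal : Prop := ∀ F : T.graph.Subgraph, F.Connected → T.Invariant F → F = ⊤

/-- Every edge has trivial (setwise) stabiliser. -/
def IsEdgeFree : Prop :=
  ∀ u v g, T.graph.Adj u v → s(T.act u g, T.act v g) = s(u, v) → g = 1

/-- The setwise stabiliser `{g | A · g = A}` of a set of vertices. -/
def setStabilizer (A : Set T.V) : Subgroup G where
  carrier := {g | ∀ v, v ∈ A ↔ T.act v g ∈ A}
  one_mem' := fun v => by rw [T.act_one]
  mul_mem' := fun {g h} hg hh v => by rw [T.act_mul, hg v, hh (T.act v g)]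
  inv_mem' := fun {g} hg v => by rw [hg (T.act v g⁻¹), T.act_inv_act]

/-- The stabiliser of a vertex. -/
def stab (v : T.V) : Subgroup G where
  carrier := {g | T.act v g = v}
  one_mem' := T.act_one v
  mul_mem' := fun {g h} hg hh => by
    change T.act v (g * h) = v
    rw [T.act_mul, show T.act v g = v from hg, show T.act v h = v from hh]
  inv_mem' := fun {g} hg => by
    change T.act v g⁻¹ = v
    rw [T.act_inv_eq_iff, show T.act v g = v from hg]

/-- The vertex set of a component of a subforest. -/
def componentVerts (F : T.graph.Subgraph) (A : F.coe.ConnectedComponent) : Set T.V :=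
  Subtype.val '' A.supp

/-- A subforest is `𝒢`-elliptic if the setwise stabiliser of each of its components is in `𝒢`.
(A component is a subtree of the tree, and so it is determined by its vertices.) -/
def ForestElliptic (𝒢 : Set (Subgroup G)) (F : T.graph.Subgraph) : Prop :=
  ∀ A : F.coe.ConnectedComponent, T.setStabilizer (T.componentVerts F A) ∈ 𝒢

/-- A subforest is `𝒢`-hyperbolic if it is not `𝒢`-elliptic. -/
def ForestHyperbolic (𝒢 : Set (Subgroup G)) (F : T.graph.Subgraph) : Prop :=
  ¬ T.ForestElliptic 𝒢 F

/-- The `G`-tree `α T`: same tree and metric, with the action twisted by `α`. -/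
def twist (a : MulAut G) : GTree G where
  toMetricTree := T.toMetricTree
  act := fun v g => T.act v (a g)
  act_one := fun v => by rw [map_one, T.act_one]
  act_mul := fun v g h => by rw [map_mul, T.act_mul]
  act_adj := fun u v g => T.act_adj u v (a g)
  act_len := fun u v g => T.act_len u v (a g)
  no_inversion := fun u v g => T.no_inversion u v (a g)

/-- `f : T → S` is an `𝒪`-map: equivariant and Lipschitz continuous. -/
def IsOMap {T S : GTree G} (f : T.Point → S.Point) : Prop :=
  (∀ x g, f (T.actPoint x g) = S.actPoint (f x) g) ∧ MetricTree.IsLipschitz f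

/-- `f : T → α T` topologically represents `α`: it is a straight `𝒪`-map. -/
def Represents (a : MulAut G) (f : T.Point → (T.twist a).Point) : Prop :=
  IsOMap f ∧ MetricTree.IsStraight f

/-! ### The quotient graph -/

/-- Orbits of vertices. -/
def vertexSetoid : Setoid T.V where
  r u v := ∃ g, T.act u g = v
  iseqv :=
    ⟨fun v => ⟨1, T.act_one v⟩,
     fun {u v} ⟨g, h⟩ => ⟨g⁻¹, by rw [← h, act_act_inv]⟩,
     fun {u v w} ⟨g, h⟩ ⟨k, l⟩ => ⟨g * k, by rw [T.act_mul, h, l]⟩⟩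

/-- Orbits of oriented edges. -/
def dartSetoid : Setoid T.graph.Dart where
  r d e := ∃ g, T.act d.fst g = e.fst ∧ T.act d.snd g = e.snd
  iseqv :=
    ⟨fun d => ⟨1, T.act_one _, T.act_one _⟩,
     fun {d e} ⟨g, h, h'⟩ => ⟨g⁻¹, by rw [← h, act_act_inv], by rw [← h', act_act_inv]⟩,
     fun {d e k} ⟨g, h, h'⟩ ⟨l, m, m'⟩ =>
      ⟨g * l, by rw [T.act_mul, h, m], by rw [T.act_mul, h', m']⟩⟩

/-- Orbits of points. -/
def pointSetoid : Setoid T.Point where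
  r x y := ∃ g, T.actPoint x g = y
  iseqv :=
    ⟨fun x => ⟨1, Subtype.ext (by funext w; simp [actPoint, T.act_one])⟩,
     fun {x y} ⟨g, h⟩ => ⟨g⁻¹, Subtype.ext (by
        funext w; simp [← h, actPoint, act_act_inv])⟩,
     fun {x y z} ⟨g, h⟩ ⟨k, l⟩ => ⟨g * k, Subtype.ext (by
        funext w; simp [← l, ← h, actPoint, T.act_mul])⟩⟩

end GTree

/-- A graph in the sense of Serre. -/
structure SerreGraph where
  V : Type u
  E : Type u
  inv : E → E
  inv_ne : ∀ e, inv e ≠ e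
  inv_inv : ∀ e, inv (inv e) = e
  ini : E → V

namespace SerreGraph

/-- The terminal vertex of an edge. -/
def ter (Y : SerreGraph.{u}) (e : Y.E) : Y.V := Y.ini (Y.inv e)

/-- A subgraph of a Serre graph. -/
structure Sub (Y : SerreGraph.{u}) where
  verts : Set Y.V
  edges : Set Y.E
  inv_mem : ∀ e ∈ edges, Y.inv e ∈ edges
  ini_mem : ∀ e ∈ edges, Y.ini e ∈ verts

/-- A subgraph is proper if it is not the whole graph. -/
def Sub.IsProper {Y : SerreGraph.{u}} (Z : Y.Sub) : Prop :=
  ¬ (Z.verts = Set.univ ∧ Z.edges = Set.univ)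

end SerreGraph

namespace GTree

variable {G : Type u} [Group G] (T : GTree G)

/-- The quotient graph `T / G`. -/
def quotientGraph : SerreGraph.{u} where
  V := Quotient T.vertexSetoid
  E := Quotient T.dartSetoid
  inv := Quotient.map (sa := T.dartSetoid) (sb := T.dartSetoid) (fun d => d.symm)
    (fun _ _ ⟨g, h, h'⟩ => ⟨g, h', h⟩)
  inv_ne := by
    intro e
    induction e using Quotient.inductionOn with
    | h d =>
      intro h
      obtain ⟨g, h1, h2⟩ := Quotient.exact (s := T.dartSetoid) h
      exact T.no_inversion d.snd d.fst g d.adj.symm ⟨h1, h2⟩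
  inv_inv := by
    intro e
    induction e using Quotient.inductionOn with
    | h d => exact congrArg (Quotient.mk T.dartSetoid) (SimpleGraph.Dart.symm_symm d)
  ini := Quotient.map (sa := T.dartSetoid) (sb := T.vertexSetoid) (fun d => d.fst)
    (fun _ _ ⟨g, h, _⟩ => ⟨g, h⟩)

/-- The action is cocompact: the quotient graph is finite. -/
def IsCocompact : Prop := Finite T.quotientGraph.V ∧ Finite T.quotientGraph.E

/-- The orbit space of the set of points, that is, the quotient graph `T / G` as a space. -/
def OrbitSpace : Type u := Quotient T.pointSetoid

/-- The map `φ : T / G → T / G` induced by an equivariant map `f : T → α T`. -/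
def inducedMap (a : MulAut G) (f : T.Point → (T.twist a).Point)
    (hf : ∀ x g, f (T.actPoint x g) = (T.twist a).actPoint (f x) g) :
    T.OrbitSpace → T.OrbitSpace :=
  Quotient.map (sa := T.pointSetoid) (sb := T.pointSetoid) f (by
    rintro x y ⟨g, rfl⟩
    refine ⟨a g, ?_⟩
    rw [hf x g]
    refine Subtype.ext ?_
    funext w
    simp [actPoint, twist])

/-- The subspace of `T / G` given by a subgraph. -/
def quotientCarrier (Z : T.quotientGraph.Sub) : Set T.OrbitSpace :=
  {q | ∃ x : T.Point, Quotient.mk T.pointSetoid x = q ∧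
    ((∃ v, Quotient.mk T.vertexSetoid v ∈ Z.verts ∧ x = T.vertexPoint v) ∨
      ∃ d : T.graph.Dart, Quotient.mk T.dartSetoid d ∈ Z.edges ∧
        MetricTree.OnEdge x d.fst d.snd)}

/-- The data defining a quotient graph of groups on `T / G` (for an edge-free `G`-tree) and its
identification with `G`. The map `lift` lifts a maximal tree of `T / G` to a representative tree
in `T`; the vertex group at `v` is the stabiliser of `lift v`, and edge groups are trivial. Every
edge `e` lifts to an edge from `lift (ini e)` to `lift (ter e) · (elt e)⁻¹`; under the
isomorphism between the fundamental group of the graph of groups and `G`, the edge `e`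
corresponds to `elt e`, which is trivial if `e` is in the maximal tree. -/
structure QuotientGraphOfGroups where
  lift : T.quotientGraph.V → T.V
  mk_lift : ∀ v, Quotient.mk T.vertexSetoid (lift v) = v
  tree : (T.graph.induce (Set.range lift)).Connected
  elt : T.quotientGraph.E → G
  lift_edge : ∀ e, ∃ d : T.graph.Dart, Quotient.mk T.dartSetoid d = e ∧
    d.fst = lift (T.quotientGraph.ini e) ∧
    d.snd = T.act (lift (T.quotientGraph.ter e)) (elt e)⁻¹
  elt_inv : ∀ e, elt (T.quotientGraph.inv e) = (elt e)⁻¹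
  elt_tree : ∀ d : T.graph.Dart, d.fst ∈ Set.range lift → d.snd ∈ Set.range lift →
    elt (Quotient.mk T.dartSetoid d) = 1

namespace QuotientGraphOfGroups

variable {T} (X : T.QuotientGraphOfGroups)

/-- `PathElt Z v w x`: the element `x` of `G` is a product `g₀ e₁ g₁ e₂ ⋯ eₙ gₙ`, where
`e₁ ⋯ eₙ` is an edge path in the subgraph `Z` from `v` to `w` and each `gᵢ` is in the vertex
group of the respective vertex of the path. -/
inductive PathElt (Z : T.quotientGraph.Sub) (v : T.quotientGraph.V) :
    T.quotientGraph.V → G → Prop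
  | base (g : G) (hg : g ∈ T.stab (X.lift v)) : PathElt Z v v g
  | step (e : T.quotientGraph.E) (x g : G) (h : PathElt Z v (T.quotientGraph.ini e) x)
      (he : e ∈ Z.edges) (hg : g ∈ T.stab (X.lift (T.quotientGraph.ter e))) :
      PathElt Z v (T.quotientGraph.ter e) (x * X.elt e * g)

/-- The fundamental group, based at the vertex `v`, of the component of `v` in the
subgraph-of-groups on `Z`, as a subgroup of `G`: it consists of the elements that are given by
closed paths at `v`. -/
def fundamentalGroup (Z : T.quotientGraph.Sub) (v : T.quotientGraph.V) : Subgroup G :=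
  Subgroup.closure {x | X.PathElt Z v v x}

/-- A subgraph of `T / G` is `𝒢`-elliptic if the fundamental group of each component of the
corresponding subgraph-of-groups is in `𝒢`. -/
def SubgraphElliptic (𝒢 : Set (Subgroup G)) (Z : T.quotientGraph.Sub) : Prop :=
  ∀ v ∈ Z.verts, X.fundamentalGroup Z v ∈ 𝒢

/-- A subgraph of `T / G` is `𝒢`-hyperbolic if it is not `𝒢`-elliptic. -/
def SubgraphHyperbolic (𝒢 : Set (Subgroup G)) (Z : T.quotientGraph.Sub) : Prop :=
  ¬ X.SubgraphElliptic 𝒢 Z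

end QuotientGraphOfGroups

/-- The `G`-tree `T` represents a point of the deformation space `𝒪(G, 𝒢)`. -/
def InDeformationSpace (𝒢 : Set (Subgroup G)) : Prop :=
  T.IsMinimal ∧ T.IsCocompact ∧ T.IsEdgeFree ∧ T.ellipticSubgroups = 𝒢

end GTree

/-! ### Free factor systems and outer automorphisms -/

variable {G : Type u} [Group G]

/-- A free factor system: the set of elliptic subgroups of a minimal, cocompact, edge-free
`G`-tree. -/
def IsFreeFactorSystem (𝒢 : Set (Subgroup G)) : Prop :=
  ∃ T : GTree G, T.IsMinimal ∧ T.IsCocompact ∧ T.IsEdgeFree ∧ 𝒢 = T.ellipticSubgroups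

/-- A free factor system is proper if `G` itself is not in it. -/
def IsProper (𝒢 : Set (Subgroup G)) : Prop := (⊤ : Subgroup G) ∉ 𝒢

variable (G) in
/-- The group of outer automorphisms. -/
abbrev Out : Type u := MulAut G ⧸ (MulAut.conj (G := G)).range

/-- The automorphisms `a` with `𝒢 a = 𝒢`. -/
def autPreserving (𝒢 : Set (Subgroup G)) : Subgroup (MulAut G) where
  carrier := {a | (fun H : Subgroup G => H.map a.toMonoidHom) '' 𝒢 = 𝒢}
  one_mem' := by
    change (fun H : Subgroup G => H.map (MonoidHom.id G)) '' 𝒢 = 𝒢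
    simp
  mul_mem' := by
    intro a b ha hb
    have h : (fun H : Subgroup G => H.map (a * b).toMonoidHom) =
        (fun H : Subgroup G => H.map a.toMonoidHom) ∘
          (fun H : Subgroup G => H.map b.toMonoidHom) := by
      funext H
      exact (Subgroup.map_map H a.toMonoidHom b.toMonoidHom).symm
    change _ '' 𝒢 = 𝒢
    rw [h, Set.image_comp, show _ '' 𝒢 = 𝒢 from hb, show _ '' 𝒢 = 𝒢 from ha]
  inv_mem' := by
    intro a ha
    have h : (fun H : Subgroup G => H.map a⁻¹.toMonoidHom) ∘
        (fun H : Subgroup G => H.map a.toMonoidHom) = id := by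
      funext H
      refine (Subgroup.map_map H a⁻¹.toMonoidHom a.toMonoidHom).trans ?_
      have : a⁻¹.toMonoidHom.comp a.toMonoidHom = MonoidHom.id G := by
        ext x
        exact MulAut.inv_apply_self G a x
      rw [this, Subgroup.map_id, id]
    change _ '' 𝒢 = 𝒢
    conv_lhs => rw [← show _ '' 𝒢 = 𝒢 from ha]
    rw [← Set.image_comp, h, Set.image_id]

instance : (MulAut.conj (G := G)).range.Normal where
  conj_mem := by
    rintro _ ⟨g, rfl⟩ a
    refine ⟨a g, ?_⟩
    ext x
    simp [MulAut.conj_apply]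

/-- The group `Out(G, 𝒢)` of the outer automorphisms for which `𝒢` is invariant. (A free factor
system is closed under conjugation, so that invariance does not depend on the representative.) -/
def OutPreserving (𝒢 : Set (Subgroup G)) : Subgroup (Out G) :=
  (autPreserving 𝒢).map (QuotientGroup.mk' _)

/-- `α` is irreducible with respect to `𝒢`: among the proper `α`-invariant free factor systems,
`𝒢` is maximal with respect to inclusion. -/
def IsIrreducible (𝒢 : Set (Subgroup G)) (α : Out G) : Prop :=
  Maximal (fun ℋ : Set (Subgroup G) =>
    IsFreeFactorSystem ℋ ∧ IsProper ℋ ∧ α ∈ OutPreserving ℋ) 𝒢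

/-- `α` is reducible with respect to `𝒢`. -/
def IsReducible (𝒢 : Set (Subgroup G)) (α : Out G) : Prop := ¬ IsIrreducible 𝒢 α

end FreeFactor

open FreeFactor

/-! Collapsing every component of a proper invariant forest `F` to a point gives another minimal,
cocompact, edge-free tree. Its elliptic subgroups include those of `T`, strictly so if some
component of `F` has a non-elliptic stabiliser. `G` is not among them, since a `G`-invariant
component would be an invariant subtree. Hence `α` is reducible as soon as it preserves this larger
system. A subgraph of the quotient is handled by passing to its preimage in `T`.

The map `f` sends components of the forest into components
(`MetricTree.reachable_of_mapsTo_carrier`). This alone shows that `α` maps elliptic subgroups of the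
collapsed tree to elliptic subgroups; equality of the two systems needs two further ideas.

First, `F` is taken minimal among the invariant, preserved forests with a hyperbolic component
inside the given one; cocompactness leaves only finitely many candidates. The components that
receive the image of a hyperbolic component form another such forest
(`GTree.IsHyperbolicForest.hyperbolicImage`), so by minimality they account for all edges of `F`.
Consequently the induced map on the collapsed tree hits every vertex with non-trivial stabiliser.
The other vertices lie in free orbits, where a twisted surjection can be written down by hand.

Second, a surjective twisted-equivariant self-map of the vertices of a cocompact edge-free tree is
injective (`GTree.IsEdgeFree.injective_of_surjective`). The boundary map identifies the edge module,
which is free of finite rank over the real group ring, with the augmentation kernel of the vertex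
module. Kaplansky's theorem says that a surjective endomorphism of such a module is injective
(`IsEquivariant.injective_of_surjective`); it is proved with the trace on the Hilbert space of
square summable functions. With injectivity, the stabiliser of the image of a vertex is exactly the
image under `α` of its stabiliser, so the system is preserved. -/

namespace FreeFactor

/-! ### Direct finiteness of real group rings -/

section Kaplansky

variable {ι : Type*} {G : Type*} [Group G]

/-- Right translation on the free `G`-set `ι × G`. -/
def rightTranslation (ι : Type*) {G : Type*} [Group G] (h : G) : ι × G ≃ ι × G :=
  (Equiv.refl ι).prodCongr (Equiv.mulRight h)

@[simp] theorem rightTranslation_apply (h : G) (i : ι) (g : G) :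
    rightTranslation ι h (i, g) = (i, g * h) := rfl

/-- A linear endomorphism of `ℝ[ι × G]` commutes with the right translations. -/
def IsEquivariant (A : (ι × G →₀ ℝ) →ₗ[ℝ] (ι × G →₀ ℝ)) : Prop :=
  ∀ h m, A (m.mapDomain (rightTranslation ι h)) = (A m).mapDomain (rightTranslation ι h)

theorem isEquivariant_of_single {A : (ι × G →₀ ℝ) →ₗ[ℝ] (ι × G →₀ ℝ)}
    (hA : ∀ h x, A (Finsupp.single (rightTranslation ι h x) 1) =
      (A (Finsupp.single x 1)).mapDomain (rightTranslation ι h)) : IsEquivariant A := by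
  intro h m
  have : A ∘ₗ Finsupp.lmapDomain ℝ ℝ (rightTranslation ι h) =
      Finsupp.lmapDomain ℝ ℝ (rightTranslation ι h) ∘ₗ A := by
    refine Finsupp.lhom_ext' fun x => LinearMap.ext_ring ?_
    simpa [Finsupp.mapDomain_single] using hA h x
  exact LinearMap.congr_fun this m

/-- The matrix entries of an endomorphism. -/
noncomputable def entry (A : (ι × G →₀ ℝ) →ₗ[ℝ] (ι × G →₀ ℝ)) (x y : ι × G) : ℝ :=
  A (Finsupp.single x 1) y

-- In `entry A x y` the input is `x` and the output coordinate is `y`, so endomorphisms act on row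
-- vectors and composites multiply in the order of application.
omit [Group G] in
theorem apply_eq_finsum (A : (ι × G →₀ ℝ) →ₗ[ℝ] (ι × G →₀ ℝ)) (m : ι × G →₀ ℝ) (y : ι × G) :
    A m y = ∑ᶠ w, m w * entry A w y := by
  rw [finsum_eq_sum_of_support_subset (s := m.support)]
  · conv_lhs => rw [← Finsupp.sum_single m]
    rw [Finsupp.sum, map_sum, Finsupp.finsetSum_apply]
    refine Finset.sum_congr rfl fun w _ => ?_
    rw [← mul_one (m w), ← smul_eq_mul, ← Finsupp.smul_single, map_smul]
    simp [entry]
  · intro w hw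
    simp only [Function.mem_support] at hw
    simpa using left_ne_zero_of_mul hw

theorem IsEquivariant.entry_translation {A : (ι × G →₀ ℝ) →ₗ[ℝ] (ι × G →₀ ℝ)}
    (hA : IsEquivariant A) (h : G) (x y : ι × G) :
    entry A (rightTranslation ι h x) (rightTranslation ι h y) = entry A x y := by
  unfold entry
  rw [← Finsupp.mapDomain_single, hA, Finsupp.mapDomain_apply (rightTranslation ι h).injective]

/-- By translation invariance every entry of a column occurs in one of the finitely many rows `(i,
1)`, each of which has finite support. -/
theorem IsEquivariant.finite_column [Finite ι] {A : (ι × G →₀ ℝ) →ₗ[ℝ] (ι × G →₀ ℝ)}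
    (hA : IsEquivariant A) (y : ι × G) : {w | entry A w y ≠ 0}.Finite := by
  have hfin : (⋃ i : ι, (fun z : ι × G => (i, z.2⁻¹ * y.2)) ''
      ((A (Finsupp.single (i, 1) 1)).support : Set (ι × G))).Finite :=
    Set.finite_iUnion fun i => (Finset.finite_toSet _).image _
  refine hfin.subset ?_
  rintro ⟨i, g⟩ hw
  refine Set.mem_iUnion.2 ⟨i, (y.1, y.2 * g⁻¹), ?_, by simp⟩
  have := hA.entry_translation g (i, 1) (y.1, y.2 * g⁻¹)
  simp only [rightTranslation_apply, one_mul, inv_mul_cancel_right] at this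
  simp only [Finset.mem_coe, Finsupp.mem_support_iff]
  change entry A _ _ ≠ 0
  rw [← this]
  exact hw

/-- The trace property for kernels that are invariant under the diagonal translations. -/
theorem trace_comm [Fintype ι] {p s : ι × G → ι × G → ℝ}
    (hp : ∀ h x y, p (rightTranslation ι h x) (rightTranslation ι h y) = p x y)
    (hs : ∀ h x y, s (rightTranslation ι h x) (rightTranslation ι h y) = s x y)
    (hps : ∀ i : ι, {w | p (i, 1) w * s w (i, 1) ≠ 0}.Finite)
    (hsp : ∀ i : ι, {w | s (i, 1) w * p w (i, 1) ≠ 0}.Finite) :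
    ∑ i : ι, ∑ᶠ w, p (i, 1) w * s w (i, 1) = ∑ i : ι, ∑ᶠ w, s (i, 1) w * p w (i, 1) := by
  have key : ∀ p s : ι × G → ι × G → ℝ, (∀ i : ι, {w | p (i, 1) w * s w (i, 1) ≠ 0}.Finite) →
      ∑ i : ι, ∑ᶠ w, p (i, 1) w * s w (i, 1) =
        ∑ᶠ z : ι × (ι × G), p (z.1, 1) z.2 * s z.2 (z.1, 1) := by
    intro p s h
    rw [finsum_curry, finsum_eq_sum_of_fintype]
    have hfin : (⋃ i : ι, (fun w : ι × G => (i, w)) ''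
        {w | p (i, 1) w * s w (i, 1) ≠ 0}).Finite := Set.finite_iUnion fun i => (h i).image _
    refine hfin.subset ?_
    rintro ⟨i, w⟩ hw
    exact Set.mem_iUnion.2 ⟨i, w, hw, rfl⟩
  rw [key p s hps, key s p hsp]
  -- Translating the pair `(j, 1)`, `(i, g⁻¹)` by `g` gives `(j, g)`, `(i, 1)`; this involution
  -- therefore matches the terms of the two double sums.
  let e : ι × (ι × G) ≃ ι × (ι × G) :=
    ⟨fun z => (z.2.1, (z.1, z.2.2⁻¹)), fun z => (z.2.1, (z.1, z.2.2⁻¹)),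
      fun z => by simp, fun z => by simp⟩
  rw [← finsum_comp_equiv e]
  refine finsum_congr fun z => ?_
  obtain ⟨i, j, g⟩ := z
  have h1 := hp g (j, 1) (i, g⁻¹)
  have h2 := hs g (i, g⁻¹) (j, 1)
  simp only [rightTranslation_apply, one_mul, inv_mul_cancel] at h1 h2
  simp only [e, Equiv.coe_fn_mk]
  rw [mul_comm, ← h1, ← h2]

theorem trace_mul_comm [Fintype ι] {A B : (ι × G →₀ ℝ) →ₗ[ℝ] (ι × G →₀ ℝ)}
    (hA : IsEquivariant A) (hB : IsEquivariant B) :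
    ∑ i : ι, entry (B ∘ₗ A) (i, 1) (i, 1) = ∑ i : ι, entry (A ∘ₗ B) (i, 1) (i, 1) := by
  have h1 : ∀ (A B : (ι × G →₀ ℝ) →ₗ[ℝ] (ι × G →₀ ℝ)) (i : ι),
      entry (B ∘ₗ A) (i, 1) (i, 1) = ∑ᶠ w, entry A (i, 1) w * entry B w (i, 1) :=
    fun A B i => apply_eq_finsum B _ _
  simp only [h1]
  have h2 : ∀ (A B : (ι × G →₀ ℝ) →ₗ[ℝ] (ι × G →₀ ℝ)) (i : ι),
      {w | entry A (i, 1) w * entry B w (i, 1) ≠ 0}.Finite := fun A B i =>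
    (A (Finsupp.single (i, 1) 1)).support.finite_toSet.subset fun w hw => by
      simpa [entry] using left_ne_zero_of_mul hw
  exact trace_comm hA.entry_translation hB.entry_translation (h2 A B) (h2 B A)

/-! ### The Hilbert space completion and the proof of Kaplansky's theorem. -/

variable (ι G) in
/-- The Hilbert space of square summable functions on `ι × G`. -/
abbrev RegularHilbert : Type _ := lp (fun _ : ι × G => ℝ) 2

variable (ι G) in
/-- The standard Hilbert basis. -/
noncomputable def stdBasis : HilbertBasis (ι × G) ℝ (RegularHilbert ι G) :=
  HilbertBasis.ofRepr (LinearIsometryEquiv.refl ℝ _)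

variable (ι G) in
/-- Finitely supported functions are square summable. -/
noncomputable def toHilbert : (ι × G →₀ ℝ) →ₗ[ℝ] RegularHilbert ι G :=
  Finsupp.linearCombination ℝ (stdBasis ι G)

omit [Group G] in
theorem toHilbert_single (x : ι × G) :
    toHilbert ι G (Finsupp.single x 1) = stdBasis ι G x := by
  simp [toHilbert]

omit [Group G] in
theorem inner_toHilbert (m : ι × G →₀ ℝ) (x : ι × G) :
    inner ℝ (toHilbert ι G m) (stdBasis ι G x) = m x := by
  classical
  simpa [toHilbert] using (stdBasis ι G).orthonormal.inner_left_finsupp m x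

/-- Right translation on the Hilbert space. -/
theorem exists_hilbertTranslation (h : G) :
    ∃ U : RegularHilbert ι G ≃ₗᵢ[ℝ] RegularHilbert ι G,
      ∀ m, U (toHilbert ι G m) = toHilbert ι G (m.mapDomain (rightTranslation ι h)) := by
  have hon : Orthonormal ℝ (stdBasis ι G ∘ rightTranslation ι h) :=
    (stdBasis ι G).orthonormal.comp _ (rightTranslation ι h).injective
  let b' := HilbertBasis.mk hon (by
    rw [Set.range_comp, (rightTranslation ι h).surjective.range_eq, Set.image_univ,
      (stdBasis ι G).dense_span])
  refine ⟨(stdBasis ι G).repr.trans b'.repr.symm, fun m => ?_⟩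
  have hb : ∀ x, ((stdBasis ι G).repr.trans b'.repr.symm) (stdBasis ι G x) =
      stdBasis ι G (rightTranslation ι h x) := by
    classical
    intro x
    rw [LinearIsometryEquiv.trans_apply, HilbertBasis.repr_self, HilbertBasis.repr_symm_single]
    exact congrFun (HilbertBasis.coe_mk hon _) x
  have : (((stdBasis ι G).repr.trans b'.repr.symm).toLinearEquiv.toLinearMap) ∘ₗ toHilbert ι G =
      toHilbert ι G ∘ₗ Finsupp.lmapDomain ℝ ℝ (rightTranslation ι h) := by
    refine Finsupp.lhom_ext' fun x => LinearMap.ext_ring ?_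
    simpa [Finsupp.mapDomain_single, toHilbert_single] using hb x
  exact LinearMap.congr_fun this m

/-- The closure of the kernel of `A` in the Hilbert space. -/
noncomputable def kerClosure (A : (ι × G →₀ ℝ) →ₗ[ℝ] (ι × G →₀ ℝ)) :
    Submodule ℝ (RegularHilbert ι G) :=
  ((LinearMap.ker A).map (toHilbert ι G)).topologicalClosure

instance (A : (ι × G →₀ ℝ) →ₗ[ℝ] (ι × G →₀ ℝ)) : CompleteSpace (kerClosure A) :=
  (Submodule.isClosed_topologicalClosure _).completeSpace_coe

omit [Group G] in
theorem kerClosure_induction (A : (ι × G →₀ ℝ) →ₗ[ℝ] (ι × G →₀ ℝ))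
    {S : Set (RegularHilbert ι G)} (hS : IsClosed S) (h : ∀ m, A m = 0 → toHilbert ι G m ∈ S)
    {z : RegularHilbert ι G} (hz : z ∈ kerClosure A) : z ∈ S := by
  refine closure_minimal ?_ hS hz
  rintro _ ⟨m, hm, rfl⟩
  exact h m hm

omit [Group G] in
theorem toHilbert_mem_kerClosure {A : (ι × G →₀ ℝ) →ₗ[ℝ] (ι × G →₀ ℝ)} {m : ι × G →₀ ℝ}
    (hm : A m = 0) : toHilbert ι G m ∈ kerClosure A :=
  Submodule.le_topologicalClosure _ ⟨m, hm, rfl⟩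

/-- The matrix entries of the orthogonal projection to the closure of the kernel. -/
noncomputable def projEntry (A : (ι × G →₀ ℝ) →ₗ[ℝ] (ι × G →₀ ℝ)) (x y : ι × G) : ℝ :=
  inner ℝ ((kerClosure A).starProjection (stdBasis ι G x)) (stdBasis ι G y)

/-- The translation is an isometry which, together with its inverse, preserves the closed kernel, so
it commutes with the orthogonal projection onto it. -/
theorem IsEquivariant.projEntry_translation {A : (ι × G →₀ ℝ) →ₗ[ℝ] (ι × G →₀ ℝ)}
    (hA : IsEquivariant A) (h : G) (x y : ι × G) :
    projEntry A (rightTranslation ι h x) (rightTranslation ι h y) = projEntry A x y := by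
  obtain ⟨U, hU⟩ := exists_hilbertTranslation (ι := ι) h
  have hUb : ∀ x, U (stdBasis ι G x) = stdBasis ι G (rightTranslation ι h x) := fun x => by
    simpa [Finsupp.mapDomain_single, toHilbert_single] using hU (Finsupp.single x 1)
  have hK : ∀ z ∈ kerClosure A, U z ∈ kerClosure A := fun z hz => by
    refine kerClosure_induction A (S := U ⁻¹' (kerClosure A : Set _))
      ((Submodule.isClosed_topologicalClosure _).preimage U.continuous) (fun m hm => ?_) hz
    simp only [Set.mem_preimage, SetLike.mem_coe, hU]
    exact toHilbert_mem_kerClosure (by rw [hA, hm, Finsupp.mapDomain_zero])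
  have hK' : ∀ z ∈ kerClosure A, U.symm z ∈ kerClosure A := fun z hz => by
    refine kerClosure_induction A (S := U.symm ⁻¹' (kerClosure A : Set _))
      ((Submodule.isClosed_topologicalClosure _).preimage U.symm.continuous) (fun m hm => ?_) hz
    have h1 : U.symm (toHilbert ι G m) =
        toHilbert ι G (m.mapDomain (rightTranslation ι h⁻¹)) := by
      rw [LinearIsometryEquiv.symm_apply_eq, hU, ← Finsupp.mapDomain_comp]
      have : rightTranslation ι h ∘ rightTranslation ι h⁻¹ = (id : ι × G → ι × G) := by
        funext ⟨i, g⟩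
        simp
      rw [this, Finsupp.mapDomain_id]
    simp only [Set.mem_preimage, SetLike.mem_coe, h1]
    exact toHilbert_mem_kerClosure (by rw [hA, hm, Finsupp.mapDomain_zero])
  have hP : (kerClosure A).starProjection (U (stdBasis ι G x)) =
      U ((kerClosure A).starProjection (stdBasis ι G x)) := by
    apply Submodule.eq_starProjection_of_mem_of_inner_eq_zero
    · exact hK _ (Submodule.starProjection_apply_mem _ _)
    · intro w hw
      rw [← map_sub, ← U.apply_symm_apply w, U.inner_map_map]
      exact Submodule.starProjection_inner_eq_zero _ _ (hK' w hw)
  unfold projEntry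
  rw [← hUb, ← hUb, hP, U.inner_map_map]

/-- A surjective endomorphism of a free right module of finite rank over a real group ring is
injective. -/
theorem IsEquivariant.injective_of_surjective [Finite ι]
    {A : (ι × G →₀ ℝ) →ₗ[ℝ] (ι × G →₀ ℝ)} (hA : IsEquivariant A)
    (hsurj : Function.Surjective A) : Function.Injective A := by
  classical
  have : Fintype ι := Fintype.ofFinite ι
  choose r hr using fun j : ι => hsurj (Finsupp.single (j, 1) 1)
  -- An equivariant right inverse of `A`: preimages are chosen on the basis elements `(j, 1)` and
  -- then translated.
  let R : (ι × G →₀ ℝ) →ₗ[ℝ] (ι × G →₀ ℝ) :=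
    Finsupp.linearCombination ℝ fun x => (r x.1).mapDomain (rightTranslation ι x.2)
  have hRs : ∀ x, R (Finsupp.single x 1) = (r x.1).mapDomain (rightTranslation ι x.2) := fun x => by
    simp [R]
  have hR : IsEquivariant R := isEquivariant_of_single fun h x => by
    obtain ⟨i, g⟩ := x
    rw [hRs, hRs, ← Finsupp.mapDomain_comp]
    congr 1
    funext ⟨j, k⟩
    simp [mul_assoc]
  have hAR : A ∘ₗ R = LinearMap.id := by
    refine Finsupp.lhom_ext' fun x => LinearMap.ext_ring ?_
    obtain ⟨i, g⟩ := x
    simp only [LinearMap.comp_apply, Finsupp.lsingle_apply, LinearMap.id_apply, hRs, hA _ _, hr,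
      Finsupp.mapDomain_single, rightTranslation_apply, one_mul]
  -- A non-orthogonal projection onto the kernel of `A`. Its trace vanishes because `R ∘ₗ A` and `A
  -- ∘ₗ R = id` have equal traces.
  let q : (ι × G →₀ ℝ) →ₗ[ℝ] (ι × G →₀ ℝ) := LinearMap.id - R ∘ₗ A
  have hq : IsEquivariant q := fun h m => by
    simp only [q, LinearMap.sub_apply, LinearMap.id_apply, LinearMap.comp_apply, hA h m, hR h _]
    exact ((Finsupp.lmapDomain ℝ ℝ (rightTranslation ι h)).map_sub _ _).symm
  have hqA : ∀ m, A (q m) = 0 := fun m => by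
    have := LinearMap.congr_fun hAR (A m)
    simp only [LinearMap.comp_apply, LinearMap.id_apply] at this
    simp [q, this]
  have hqker : ∀ m, A m = 0 → q m = m := fun m hm => by simp [q, hm]
  have hone : ∀ i : ι, entry (LinearMap.id : (ι × G →₀ ℝ) →ₗ[ℝ] _) (i, 1) (i, 1) = 1 := fun i => by
    simp [entry]
  have htrq : ∑ i : ι, entry q (i, 1) (i, 1) = 0 := by
    have h1 := trace_mul_comm hA hR
    rw [hAR] at h1
    have h2 : ∀ i : ι, entry q (i, 1) (i, 1) =
      entry (LinearMap.id : (ι × G →₀ ℝ) →ₗ[ℝ] _) (i, 1) (i, 1) -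
        entry (R ∘ₗ A) (i, 1) (i, 1) := fun i => by simp [entry, q]
    rw [Finset.sum_congr rfl fun i _ => h2 i, Finset.sum_sub_distrib, h1, sub_self]
  -- Since the columns of `q` are finite, "`q` fixes `z`" is a closed condition coordinate by
  -- coordinate, and so it extends from the kernel to its closure.
  have hcol : ∀ y, ∀ z ∈ kerClosure A,
      ∑ w ∈ (hq.finite_column y).toFinset, inner ℝ z (stdBasis ι G w) * entry q w y =
        inner ℝ z (stdBasis ι G y) := fun y z hz => by
    refine kerClosure_induction A (S := {z | ∑ w ∈ (hq.finite_column y).toFinset,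
      inner ℝ z (stdBasis ι G w) * entry q w y = inner ℝ z (stdBasis ι G y)})
      (isClosed_eq (by fun_prop) (by fun_prop)) (fun m hm => ?_) hz
    simp only [Set.mem_ofPred_eq, inner_toHilbert]
    conv_rhs => rw [← hqker m hm, apply_eq_finsum]
    rw [finsum_eq_sum_of_support_subset]
    intro w hw
    simpa using right_ne_zero_of_mul hw
  -- Let `p` be the orthogonal projection. As row matrices `p = p q`, since `q` is the identity on
  -- the closed kernel, and `q = q p`, since the values of `q` lie in the kernel. Hence `p` and `q`
  -- have the same trace, namely `0`.
  have hproj1 : ∀ x y, projEntry A x y = ∑ᶠ w, projEntry A x w * entry q w y := fun x y => by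
    have := hcol y _ (Submodule.starProjection_apply_mem (kerClosure A) (stdBasis ι G x))
    rw [projEntry, ← this, finsum_eq_sum_of_support_subset]
    · rfl
    · intro w hw
      simpa using right_ne_zero_of_mul hw
  have hproj2 : ∀ x y, entry q x y = ∑ᶠ w, entry q x w * projEntry A w y := fun x y => by
    have h1 : entry q x y = inner ℝ ((kerClosure A).starProjection
        (toHilbert ι G (q (Finsupp.single x 1)))) (stdBasis ι G y) := by
      rw [Submodule.starProjection_eq_self_iff.2 (toHilbert_mem_kerClosure (hqA _)),
        inner_toHilbert, entry]
    rw [h1, finsum_eq_sum_of_support_subset (s := (q (Finsupp.single x 1)).support)]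
    · rw [toHilbert, Finsupp.linearCombination_apply, Finsupp.sum, map_sum, sum_inner]
      refine Finset.sum_congr rfl fun w _ => ?_
      rw [map_smul, real_inner_smul_left, entry, projEntry]
    · intro w hw
      simpa [entry] using left_ne_zero_of_mul hw
  have htr : ∑ i : ι, projEntry A (i, 1) (i, 1) = 0 := by
    rw [← htrq, Finset.sum_congr rfl fun i _ => hproj1 (i, 1) (i, 1),
      Finset.sum_congr rfl fun i _ => hproj2 (i, 1) (i, 1)]
    refine trace_comm hA.projEntry_translation hq.entry_translation (fun i => ?_) (fun i => ?_)
    · exact (hq.finite_column (i, 1)).subset fun w hw => right_ne_zero_of_mul hw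
    · exact (q (Finsupp.single (i, 1) 1)).support.finite_toSet.subset fun w hw => by
        simpa [entry] using left_ne_zero_of_mul hw
  -- The trace of `p` is a sum of squared norms, so its vanishing forces `p` to kill every basis
  -- vector.
  have hdiag : ∀ x, projEntry A x x = ‖(kerClosure A).starProjection (stdBasis ι G x)‖ ^ 2 :=
    fun x => by
      rw [projEntry, ← real_inner_self_eq_norm_sq, Submodule.inner_starProjection_left_eq_right,
        Submodule.inner_starProjection_left_eq_right,
        Submodule.starProjection_eq_self_iff.2 (Submodule.starProjection_apply_mem _ _)]
  have hzero : ∀ x, (kerClosure A).starProjection (stdBasis ι G x) = 0 := by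
    rintro ⟨i, g⟩
    have h1 := (Finset.sum_eq_zero_iff_of_nonneg
      fun i _ => (hdiag (i, 1)).symm ▸ sq_nonneg _).1 htr i (Finset.mem_univ i)
    have h2 := hA.projEntry_translation g (i, 1) (i, 1)
    rw [h1, rightTranslation_apply, one_mul, hdiag] at h2
    simpa using h2
  rw [injective_iff_map_eq_zero]
  intro m hm
  ext x
  rw [← inner_toHilbert m x, ← Submodule.starProjection_eq_self_iff.2 (toHilbert_mem_kerClosure hm),
    Submodule.inner_starProjection_left_eq_right, hzero]
  simp

end Kaplansky

/-! ### Trees and cuts -/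

/-- An edge of the tree path from `u` to `v` that is missing from `F` would be avoided by another
walk, contradicting uniqueness of the path. So only missing edges that separate `u` from `v` can
obstruct reachability. -/
theorem _root_.SimpleGraph.IsTree.reachable_of_forall_cut {V : Type*} {H F : SimpleGraph V}
    (hH : H.IsTree) {u v : V}
    (h : ∀ p q, H.Adj p q → ¬ F.Adj p q → (H.deleteEdges {s(p, q)}).Reachable u v) :
    F.Reachable u v := by
  classical
  obtain ⟨P, hP, huniq⟩ := hH.existsUnique_path u v
  refine ⟨P.transfer F fun e he => ?_⟩
  induction e using Sym2.ind with
  | h p q =>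
    by_contra hF
    obtain ⟨w, hw⟩ := SimpleGraph.reachable_deleteEdges_iff_exists_walk.1
      (h p q (P.adj_of_mem_edges he) hF)
    have := huniq _ w.bypass_isPath
    exact hw (w.edges_bypass_subset_edges (this ▸ he))

theorem _root_.SimpleGraph.reachable_deleteEdges_iff_of_adj {V : Type*} {H : SimpleGraph V}
    {p q u a b : V} (hab : H.Adj a b) (hne : s(a, b) ≠ s(p, q)) :
    (H.deleteEdges {s(p, q)}).Reachable u a ↔ (H.deleteEdges {s(p, q)}).Reachable u b := by
  have : (H.deleteEdges {s(p, q)}).Adj a b := by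
    rw [SimpleGraph.deleteEdges_adj]
    exact ⟨hab, hne⟩
  exact ⟨fun h => h.trans this.reachable, fun h => h.trans this.symm.reachable⟩

/-! ### Barycentric coordinates, the path metric and Lipschitz maps. -/

namespace MetricTree

variable {M : MetricTree.{u}}

theorem len_pos {a b : M.V} (h : M.graph.Adj a b) : 0 < M.len s(a, b) := by
  obtain ⟨ε, hε, h'⟩ := M.len_bound a
  exact hε.trans_le (h' b h)

@[simp] theorem bary_left {V : Type u} {u v : V} (h : u ≠ v) (t : ℝ) : bary u v t u = 1 - t := by
  simp [bary, h]

@[simp] theorem bary_right {V : Type u} {u v : V} (h : u ≠ v) (t : ℝ) : bary u v t v = t := by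
  simp [bary, h.symm]

theorem bary_of_ne {V : Type u} {u v w : V} (hu : w ≠ u) (hv : w ≠ v) (t : ℝ) :
    bary u v t w = 0 := by
  simp [bary, hu, hv]

open Classical in
theorem vertexPoint_apply (v w : M.V) : (M.vertexPoint v).1 w = if w = v then 1 else 0 := by
  simp [vertexPoint, bary]

theorem vertexPoint_injective : Function.Injective M.vertexPoint := by
  intro v w h
  by_contra hne
  have : (M.vertexPoint v).1 v = (M.vertexPoint w).1 v := by rw [h]
  simp [vertexPoint_apply, hne] at this

theorem onEdge_vertexPoint_left (u v : M.V) : OnEdge (M.vertexPoint u) u v := by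
  intro w hw
  left
  by_contra h
  simp [vertexPoint_apply, h] at hw

theorem onEdge_vertexPoint_right (u v : M.V) : OnEdge (M.vertexPoint v) u v := by
  intro w hw
  right
  by_contra h
  simp [vertexPoint_apply, h] at hw

theorem exists_eq_vertexPoint_or_onEdge (x : M.Point) :
    (∃ v, x = M.vertexPoint v) ∨ ∃ u v t, M.graph.Adj u v ∧ 0 ≤ t ∧ t ≤ 1 ∧ x.1 = bary u v t := by
  obtain ⟨u, v, t, h, h0, h1, hx⟩ := x.2
  rcases h with rfl | h
  · refine Or.inl ⟨u, Subtype.ext ?_⟩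
    rw [hx]
    funext w
    simp only [vertexPoint, bary]
    ring
  · exact Or.inr ⟨u, v, t, h, h0, h1, hx⟩

theorem onEdge_bary {x : M.Point} {u v : M.V} {t : ℝ} (hx : x.1 = bary u v t) : OnEdge x u v := by
  intro w hw
  by_contra! h
  exact hw (hx ▸ bary_of_ne h.1 h.2 t)

/-- The linear extension of a function on the vertices. -/
noncomputable def linearExtension (χ : M.V → ℝ) (x : M.Point) : ℝ := ∑ᶠ w, x.1 w * χ w

theorem linearExtension_of_onEdge (χ : M.V → ℝ) {x : M.Point} {a b : M.V} (hab : a ≠ b)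
    (hx : OnEdge x a b) : linearExtension χ x = x.1 a * χ a + x.1 b * χ b := by
  classical
  rw [linearExtension, finsum_eq_sum_of_support_subset (s := {a, b}), Finset.sum_pair hab]
  intro w hw
  simpa using hx w (left_ne_zero_of_mul hw)

@[simp] theorem linearExtension_vertexPoint (χ : M.V → ℝ) (v : M.V) :
    linearExtension χ (M.vertexPoint v) = χ v := by
  classical
  rw [linearExtension, finsum_eq_single _ v]
  · simp [vertexPoint_apply]
  · intro w hw
    simp [vertexPoint_apply, hw]

theorem linearExtension_one (x : M.Point) : linearExtension (fun _ => 1) x = 1 := by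
  rcases exists_eq_vertexPoint_or_onEdge x with ⟨v, rfl⟩ | ⟨u, v, t, h, -, -, hx⟩
  · simp
  · rw [linearExtension_of_onEdge _ h.ne (onEdge_bary hx), hx, bary_left h.ne, bary_right h.ne]
    ring

theorem coord_add_coord {x : M.Point} {a b : M.V} (hab : a ≠ b) (hx : OnEdge x a b) :
    x.1 a + x.1 b = 1 := by
  simpa [linearExtension_of_onEdge _ hab hx] using linearExtension_one x

theorem PathLength.nonneg {x y : M.Point} {ℓ : ℝ} (h : PathLength x y ℓ) : 0 ≤ ℓ := by
  induction h with
  | refl => exact le_rfl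
  | step x y z u v ℓ huv hx hy h ih => have := len_pos huv; positivity

theorem PathLength.exists_trans {x y z : M.Point} {ℓ ℓ' : ℝ} (h : PathLength x y ℓ)
    (h' : PathLength y z ℓ') : ∃ k, PathLength x z k := by
  induction h with
  | refl => exact ⟨_, h'⟩
  | step x y z u v ℓ huv hx hy h ih =>
    obtain ⟨k, hk⟩ := ih h'
    exact ⟨_, .step x y _ u v k huv hx hy hk⟩

theorem exists_pathLength (x y : M.Point) : ∃ ℓ, PathLength x y ℓ := by
  have step : ∀ (x y : M.Point) u v, M.graph.Adj u v → OnEdge x u v → OnEdge y u v →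
      ∃ ℓ, PathLength x y ℓ := fun x y u v h hx hy => ⟨_, .step x y y u v 0 h hx hy (.refl y)⟩
  have vert : ∀ u v : M.V, ∃ ℓ, PathLength (M.vertexPoint u) (M.vertexPoint v) ℓ := by
    intro u v
    obtain ⟨w⟩ := M.isTree.connected.preconnected u v
    induction w with
    | nil => exact ⟨0, .refl _⟩
    | cons h _ ih =>
      obtain ⟨ℓ, hℓ⟩ := step _ _ _ _ h (onEdge_vertexPoint_left _ _) (onEdge_vertexPoint_right _ _)
      obtain ⟨ℓ', hℓ'⟩ := ih
      exact hℓ.exists_trans hℓ'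
  have key : ∀ x : M.Point, ∃ v, (∃ ℓ, PathLength x (M.vertexPoint v) ℓ) ∧
      ∃ ℓ, PathLength (M.vertexPoint v) x ℓ := by
    intro x
    rcases exists_eq_vertexPoint_or_onEdge x with ⟨v, rfl⟩ | ⟨u, v, t, h, -, -, hx⟩
    · exact ⟨v, ⟨0, .refl _⟩, ⟨0, .refl _⟩⟩
    · exact ⟨u, step _ _ _ _ h (onEdge_bary hx) (onEdge_vertexPoint_left _ _),
        step _ _ _ _ h (onEdge_vertexPoint_left _ _) (onEdge_bary hx)⟩
  obtain ⟨u, ⟨ℓ, hℓ⟩, -⟩ := key x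
  obtain ⟨v, -, ℓ', hℓ'⟩ := key y
  obtain ⟨k, hk⟩ := vert u v
  obtain ⟨k', hk'⟩ := hℓ.exists_trans hk
  exact hk'.exists_trans hℓ'

theorem dist_nonneg (x y : M.Point) : 0 ≤ dist x y :=
  Real.sInf_nonneg fun _ h => PathLength.nonneg h

theorem dist_le_of_onEdge {x y : M.Point} {u v : M.V} (h : M.graph.Adj u v) (hx : OnEdge x u v)
    (hy : OnEdge y u v) : dist x y ≤ M.len s(u, v) * |x.1 u - y.1 u| := by
  refine csInf_le ⟨0, fun _ h => PathLength.nonneg h⟩ ?_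
  simpa using PathLength.step x y y u v 0 h hx hy (.refl y)

/-- A function on the vertices with values `0` and `1` that is constant on all edges but one has
a Lipschitz linear extension. -/
theorem len_mul_linearExtension_sub_le_dist {χ : M.V → ℝ} {p q : M.V}
    (h01 : ∀ w, χ w = 0 ∨ χ w = 1)
    (hχ : ∀ a b, M.graph.Adj a b → s(a, b) ≠ s(p, q) → χ a = χ b) (x y : M.Point) :
    M.len s(p, q) * |linearExtension χ x - linearExtension χ y| ≤ dist x y := by
  refine le_csInf (exists_pathLength x y) fun ℓ hℓ => ?_
  induction hℓ with
  | refl => simp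
  | step x y z a b ℓ hab hx hy h ih =>
    have h1 : M.len s(p, q) * |linearExtension χ x - linearExtension χ y| ≤
        M.len s(a, b) * |x.1 a - y.1 a| := by
      have hxy : linearExtension χ x - linearExtension χ y =
          (x.1 a - y.1 a) * (χ a - χ b) := by
        have h2 := coord_add_coord hab.ne hx
        have h3 := coord_add_coord hab.ne hy
        rw [linearExtension_of_onEdge χ hab.ne hx, linearExtension_of_onEdge χ hab.ne hy,
          eq_sub_of_add_eq' h2, eq_sub_of_add_eq' h3]
        ring
      rw [hxy, abs_mul]
      by_cases he : s(a, b) = s(p, q)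
      · have h4 : |χ a - χ b| ≤ 1 := by
          rcases h01 a with ha | ha <;> rcases h01 b with hb | hb <;> simp [ha, hb]
        have := len_pos hab
        rw [← he]
        gcongr
        exact mul_le_of_le_one_right (abs_nonneg _) h4
      · rw [hχ a b hab he, sub_self, abs_zero, mul_zero, mul_zero]
        have := len_pos hab
        positivity
    -- `s(p, q)` need not be an edge, so its length may be a negative default value; the bound is
    -- then trivial.
    have h2 : 0 ≤ M.len s(p, q) ∨ M.len s(p, q) < 0 := le_or_gt _ _
    rcases h2 with h2 | h2
    · have := mul_le_mul_of_nonneg_left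
        (abs_sub_le (linearExtension χ x) (linearExtension χ y) (linearExtension χ z)) h2
      linarith
    · have h3 := len_pos hab
      have h4 := h.nonneg
      have : M.len s(p, q) * |linearExtension χ x - linearExtension χ z| ≤ 0 :=
        mul_nonpos_of_nonpos_of_nonneg h2.le (abs_nonneg _)
      have : 0 ≤ M.len s(a, b) * |x.1 a - y.1 a| := by positivity
      linarith

/-- A Lipschitz map that preserves a subforest maps adjacent vertices of the subforest to vertices
of the same component. -/
theorem reachable_of_mapsTo_carrier {f : M.Point → M.Point} (hf : IsLipschitz f)
    {F : M.graph.Subgraph} (hF : Set.MapsTo f (carrier F) (carrier F)) {u v u' v' : M.V}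
    (huv : F.Adj u v) (hu : f (M.vertexPoint u) = M.vertexPoint u')
    (hv : f (M.vertexPoint v) = M.vertexPoint v') : F.spanningCoe.Reachable u' v' := by
  classical
  refine M.isTree.reachable_of_forall_cut fun p q hpq hnF => ?_
  by_contra hcut
  -- The indicator of the side of the cut that contains `u'`. Its linear extension is `0` or `1` on
  -- the subforest, as `pq` is not in it, but along the image of the edge `uv` it varies
  -- continuously from `1` to `0` and must take the value `1 / 2`.
  let χ : M.V → ℝ := fun w => if (M.graph.deleteEdges {s(p, q)}).Reachable u' w then 1 else 0
  have h01 : ∀ w, χ w = 0 ∨ χ w = 1 := fun w => by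
    simp only [χ]; split_ifs <;> simp
  have hχ : ∀ a b, M.graph.Adj a b → s(a, b) ≠ s(p, q) → χ a = χ b := fun a b hab hne => by
    simp only [χ, SimpleGraph.reachable_deleteEdges_iff_of_adj hab hne]
  have hcar : ∀ x ∈ carrier F, linearExtension χ x = 0 ∨ linearExtension χ x = 1 := by
    rintro x (⟨w, -, rfl⟩ | ⟨a, b, hab, hx⟩)
    · simpa using h01 w
    · have hne : s(a, b) ≠ s(p, q) := by
        intro he
        rcases Sym2.eq_iff.1 he with ⟨rfl, rfl⟩ | ⟨rfl, rfl⟩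
        · exact hnF hab
        · exact hnF hab.symm
      rw [linearExtension_of_onEdge χ hab.ne hx, ← hχ a b (F.adj_sub hab) hne, ← add_mul,
        coord_add_coord hab.ne hx, one_mul]
      exact h01 a
  have hadj := F.adj_sub huv
  let γ : unitInterval → M.Point := fun t =>
    ⟨bary u v t, u, v, t, Or.inr hadj, t.2.1, t.2.2, rfl⟩
  have hγ : ∀ t, OnEdge (γ t) u v := fun t => onEdge_bary rfl
  obtain ⟨C, hC⟩ := hf
  have hpos := len_pos hpq
  have hlip : LipschitzWith (Real.toNNReal (|C| * M.len s(u, v) / M.len s(p, q)))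
      fun t => linearExtension χ (f (γ t)) := by
    refine LipschitzWith.of_dist_le_mul fun s t => ?_
    have h1 := len_mul_linearExtension_sub_le_dist h01 hχ (f (γ s)) (f (γ t))
    have h2 := hC (γ s) (γ t)
    have h3 := dist_le_of_onEdge hadj (hγ s) (hγ t)
    have h4 : |(γ s).1 u - (γ t).1 u| = |(s : ℝ) - t| := by
      change |bary u v s u - bary u v t u| = _
      rw [bary_left hadj.ne, bary_left hadj.ne, abs_sub_comm]
      congr 1
      ring
    have h5 : C * dist (γ s) (γ t) ≤ |C| * (M.len s(u, v) * |(s : ℝ) - t|) :=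
      (mul_le_mul_of_nonneg_right (le_abs_self C) (dist_nonneg _ _)).trans
        (mul_le_mul_of_nonneg_left (h4 ▸ h3) (abs_nonneg C))
    have h6 := len_pos hadj
    rw [Real.coe_toNNReal _ (by positivity), Real.dist_eq, Subtype.dist_eq, Real.dist_eq,
      div_mul_eq_mul_div, le_div_iff₀ hpos]
    linarith
  have hγ0 : γ 0 = M.vertexPoint u := Subtype.ext (by
    funext w; simp [γ, vertexPoint, bary])
  have hγ1 : γ 1 = M.vertexPoint v := Subtype.ext (by
    funext w; simp [γ, vertexPoint, bary])
  obtain ⟨t, ht⟩ := mem_range_of_exists_le_of_exists_ge (c := (1 / 2 : ℝ)) hlip.continuous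
    ⟨1, by rw [hγ1, hv]; simp [χ, hcut]⟩ ⟨0, by rw [hγ0, hu]; simp [χ]; norm_num⟩
  change linearExtension χ (f (γ t)) = 1 / 2 at ht
  have hmem : f (γ t) ∈ carrier F := hF (Or.inr ⟨u, v, huv, hγ t⟩)
  rcases hcar _ hmem with h | h <;> rw [h] at ht <;> norm_num at ht

end MetricTree

/-! ### Elliptic subgroups and fixed vertices. -/

namespace GTree

variable {G : Type u} [Group G] {T : GTree G}

theorem adj_act_iff {u v : T.V} (g : G) :
    T.graph.Adj (T.act u g) (T.act v g) ↔ T.graph.Adj u v := by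
  refine ⟨fun h => ?_, T.act_adj u v g⟩
  simpa [T.act_act_inv] using T.act_adj _ _ g⁻¹ h

theorem act_injective (g : G) : Function.Injective fun v => T.act v g := fun u v h => by
  simpa [T.act_act_inv] using congrArg (fun w => T.act w g⁻¹) h

theorem mem_stab {v : T.V} {g : G} : g ∈ T.stab v ↔ T.act v g = v := Iff.rfl

theorem actPoint_vertexPoint (v : T.V) (g : G) :
    T.actPoint (T.vertexPoint v) g = T.vertexPoint (T.act v g) := by
  refine Subtype.ext ?_
  funext w
  classical
  rw [MetricTree.vertexPoint_apply]
  exact (MetricTree.vertexPoint_apply _ _).trans (if_congr (T.act_inv_eq_iff _ _ _) rfl rfl)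

/-- A subgroup is elliptic if and only if it fixes a vertex. -/
theorem isElliptic_iff {H : Subgroup G} : T.IsElliptic H ↔ ∃ v, H ≤ T.stab v := by
  constructor
  · rintro ⟨x, hx⟩
    rcases MetricTree.exists_eq_vertexPoint_or_onEdge x with ⟨v, rfl⟩ | ⟨u, v, t, h, -, -, hxe⟩
    · refine ⟨v, fun g hg => MetricTree.vertexPoint_injective ?_⟩
      rw [← actPoint_vertexPoint]
      exact hx g hg
    · have hon : MetricTree.OnEdge x u v := MetricTree.onEdge_bary hxe
      have hmove : ∀ g ∈ H, ∀ w, x.1 (T.act w g⁻¹) = x.1 w := fun g hg w =>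
        congrFun (congrArg Subtype.val (hx g hg)) w
      by_cases hu : x.1 u = 0
      · refine ⟨v, fun g hg => ?_⟩
        have hv : x.1 v ≠ 0 := by
          have := MetricTree.coord_add_coord h.ne hon
          intro h0
          rw [hu, h0] at this
          norm_num at this
        rcases hon (T.act v g⁻¹) (by rwa [hmove g hg]) with h1 | h1
        · exact absurd hu (by rw [← h1, hmove g hg]; exact hv)
        · exact ((T.act_inv_eq_iff _ _ _).1 h1).symm
      · refine ⟨u, fun g hg => ?_⟩
        rcases hon (T.act u g⁻¹) (by rwa [hmove g hg]) with h1 | h1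
        · exact ((T.act_inv_eq_iff _ _ _).1 h1).symm
        · exfalso
          have hv : x.1 v ≠ 0 := by rw [← h1, hmove g hg]; exact hu
          rcases hon (T.act v g⁻¹) (by rwa [hmove g hg]) with h2 | h2
          · exact T.no_inversion u v g⁻¹ h ⟨h1, h2⟩
          · exact h.ne (act_injective g⁻¹ (h1.trans h2.symm))
  · rintro ⟨v, hv⟩
    refine ⟨T.vertexPoint v, fun g hg => ?_⟩
    rw [actPoint_vertexPoint, hv hg]

theorem mem_ellipticSubgroups {H : Subgroup G} : H ∈ T.ellipticSubgroups ↔ ∃ v, H ≤ T.stab v :=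
  isElliptic_iff

/-- The action of an element as an automorphism of the tree. -/
def actIso (T : GTree G) (g : G) : T.graph ≃g T.graph where
  toFun v := T.act v g
  invFun v := T.act v g⁻¹
  left_inv v := T.act_act_inv v g
  right_inv v := T.act_inv_act v g
  map_rel_iff' := adj_act_iff g

/-- In an edge-free tree, a non-trivial element fixes at most one vertex. -/
theorem IsEdgeFree.eq_of_act_eq (hT : T.IsEdgeFree) {g : G} (hg : g ≠ 1) {u v : T.V}
    (hu : T.act u g = u) (hv : T.act v g = v) : u = v := by
  obtain ⟨P, hP, huniq⟩ := T.isTree.existsUnique_path u v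
  have hu' : (T.actIso g).toHom u = u := hu
  have hv' : (T.actIso g).toHom v = v := hv
  -- The path between two fixed vertices is carried to itself; if it were non-trivial, its first
  -- edge would be fixed, contrary to edge-freeness.
  have hmap : (P.map (T.actIso g).toHom).copy hu' hv' = P := by
    refine huniq _ ?_
    beta_reduce
    rw [SimpleGraph.Walk.isPath_copy]
    exact hP.map (T.actIso g).injective
  cases P with
  | nil => rfl
  | cons h P' =>
    exfalso
    have h1 := congrArg (fun Q => Q.getVert 1) hmap
    simp only [SimpleGraph.Walk.getVert_copy, SimpleGraph.Walk.getVert_map,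
      SimpleGraph.Walk.getVert_cons_succ, SimpleGraph.Walk.getVert_zero] at h1
    refine hg (hT _ _ g h ?_)
    rw [hu]
    exact congrArg _ h1

/-! ### Collapsing an invariant forest -/

/-- A `G`-invariant spanning subforest. -/
structure IsInvariantForest (T : GTree G) (F : SimpleGraph T.V) : Prop where
  le : F ≤ T.graph
  adj : ∀ {u v} g, F.Adj u v → F.Adj (T.act u g) (T.act v g)

namespace IsInvariantForest

variable {F : SimpleGraph T.V} (hF : T.IsInvariantForest F)

/-- The action of an element as an endomorphism of the forest. -/
def hom (_ : T.IsInvariantForest F) (g : G) : F →g F := ⟨fun v => T.act v g, fun h => hF.adj g h⟩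

include hF

theorem reachable_act {u v : T.V} (h : F.Reachable u v) (g : G) :
    F.Reachable (T.act u g) (T.act v g) := h.map (hF.hom hF g)

theorem reachable_act_iff {u v : T.V} (g : G) :
    F.Reachable (T.act u g) (T.act v g) ↔ F.Reachable u v := by
  refine ⟨fun h => ?_, fun h => hF.reachable_act h g⟩
  simpa [T.act_act_inv] using hF.reachable_act h g⁻¹

theorem reachable_deleteEdges {a b p q : T.V} (h : F.Reachable a b) (hpq : ¬ F.Adj p q) :
    (T.graph.deleteEdges {s(p, q)}).Reachable a b := by
  refine h.mono fun x y hxy => ?_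
  rw [SimpleGraph.deleteEdges_adj]
  refine ⟨hF.le hxy, fun he => hpq ?_⟩
  rcases Sym2.eq_iff.1 he with ⟨rfl, rfl⟩ | ⟨rfl, rfl⟩
  · exact hxy
  · exact hxy.symm

/-- Two distinct components are joined by at most one edge. -/
theorem edge_unique {u v u' v' : T.V} (huv : T.graph.Adj u v) (huv' : T.graph.Adj u' v')
    (hu : F.Reachable u u') (hv : F.Reachable v v') (hne : ¬ F.Reachable u v) :
    u = u' ∧ v = v' := by
  have hbr := (SimpleGraph.isAcyclic_iff_forall_adj_isBridge.1 T.isTree.isAcyclic) huv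
  rw [SimpleGraph.isBridge_iff] at hbr
  have hnF : ¬ F.Adj u v := fun h => hne h.reachable
  by_cases he : s(u', v') = s(u, v)
  · rcases Sym2.eq_iff.1 he with ⟨rfl, rfl⟩ | ⟨rfl, rfl⟩
    · exact ⟨rfl, rfl⟩
    · exact absurd hu hne
  -- The second edge together with the forest paths would reconnect `u` and `v` after the bridge
  -- `uv` is deleted.
  · refine absurd ?_ hbr
    have h1 := hF.reachable_deleteEdges hu hnF
    have h2 := hF.reachable_deleteEdges hv hnF
    exact ((SimpleGraph.reachable_deleteEdges_iff_of_adj huv' he).1 h1).trans h2.symm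

end IsInvariantForest

/-- The graph obtained by collapsing every component of the forest `F` to a vertex. -/
def collapseGraph (T : GTree G) (F : SimpleGraph T.V) : SimpleGraph F.ConnectedComponent where
  Adj c d := c ≠ d ∧ ∃ u v, F.connectedComponentMk u = c ∧ F.connectedComponentMk v = d ∧
    T.graph.Adj u v
  symm := ⟨fun _ _ ⟨h, u, v, hu, hv, huv⟩ => ⟨h.symm, v, u, hv, hu, huv.symm⟩⟩
  loopless := ⟨fun _ h => h.1 rfl⟩

theorem reachable_collapseGraph {F H : SimpleGraph T.V} {K : SimpleGraph F.ConnectedComponent}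
    (h : ∀ u v, H.Adj u v → ¬ F.Reachable u v →
      K.Adj (F.connectedComponentMk u) (F.connectedComponentMk v)) {u v : T.V}
    (huv : H.Reachable u v) :
    K.Reachable (F.connectedComponentMk u) (F.connectedComponentMk v) := by
  obtain ⟨w⟩ := huv
  induction w with
  | nil => exact .refl _
  | @cons a b c hab _ ih =>
    refine SimpleGraph.Reachable.trans ?_ ih
    by_cases hr : F.Reachable a b
    · rw [SimpleGraph.ConnectedComponent.eq.2 hr]
    · exact (h a b hab hr).reachable

theorem reachable_of_collapseGraph {F H : SimpleGraph T.V} {K : SimpleGraph F.ConnectedComponent}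
    (hFH : ∀ u v, F.Reachable u v → H.Reachable u v)
    (h : ∀ c d, K.Adj c d → ∃ u v, F.connectedComponentMk u = c ∧ F.connectedComponentMk v = d ∧
      H.Adj u v) {u v : T.V}
    (huv : K.Reachable (F.connectedComponentMk u) (F.connectedComponentMk v)) :
    H.Reachable u v := by
  obtain ⟨w⟩ := huv
  generalize hc : F.connectedComponentMk u = c at w
  generalize hd : F.connectedComponentMk v = d at w
  induction w generalizing u with
  | nil => exact hFH _ _ (SimpleGraph.ConnectedComponent.eq.1 (hc.trans hd.symm))
  | @cons c' d' e' hcd _ ih =>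
    obtain ⟨x, y, hx, hy, hxy⟩ := h _ _ hcd
    exact (hFH _ _ (SimpleGraph.ConnectedComponent.eq.1 (hc.trans hx.symm))).trans
      (hxy.reachable.trans (ih hy hd))

/-- Walks descend to the quotient, which gives connectedness. For acyclicity, a walk in the
collapsed graph avoiding an edge lifts, through the components, to a walk in `T` avoiding the unique
edge above it, which is a bridge. -/
theorem IsInvariantForest.collapseGraph_isTree {F : SimpleGraph T.V}
    (hF : T.IsInvariantForest F) : (T.collapseGraph F).IsTree := by
  have hne : Nonempty T.V := T.isTree.connected.nonempty
  refine ⟨?_, ?_⟩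
  · have : Nonempty F.ConnectedComponent := hne.map F.connectedComponentMk
    refine ⟨fun c d => ?_⟩
    induction c using SimpleGraph.ConnectedComponent.ind with
    | h u =>
    induction d using SimpleGraph.ConnectedComponent.ind with
    | h v =>
    refine reachable_collapseGraph (H := T.graph) (K := T.collapseGraph F)
      (fun a b hab hr => ⟨fun he => hr (SimpleGraph.ConnectedComponent.eq.1 he), a, b, rfl, rfl, hab⟩)
      (T.isTree.connected.preconnected u v)
  · rw [SimpleGraph.isAcyclic_iff_forall_adj_isBridge]
    rintro _ _ ⟨hcd, u, v, rfl, rfl, huv⟩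
    rw [SimpleGraph.isBridge_iff]
    intro hr
    have hnr : ¬ F.Reachable u v := fun h => hcd (SimpleGraph.ConnectedComponent.eq.2 h)
    have hbr := (SimpleGraph.isAcyclic_iff_forall_adj_isBridge.1 T.isTree.isAcyclic) huv
    refine hbr (reachable_of_collapseGraph (fun a b hab => hF.reachable_deleteEdges hab
      fun h => hnr h.reachable) ?_ hr)
    rintro c d hcd'
    rw [SimpleGraph.deleteEdges_adj] at hcd'
    obtain ⟨⟨-, a, b, rfl, rfl, hab⟩, hne'⟩ := hcd'
    refine ⟨a, b, rfl, rfl, ?_⟩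
    rw [SimpleGraph.deleteEdges_adj]
    refine ⟨hab, fun he => hne' ?_⟩
    rcases Sym2.eq_iff.1 he with ⟨rfl, rfl⟩ | ⟨rfl, rfl⟩
    · rfl
    · exact Sym2.eq_swap

/-- The `G`-tree obtained by collapsing every component of an invariant forest to a vertex. All
edges are given length `1`. -/
def collapse (T : GTree G) (F : SimpleGraph T.V) (hF : T.IsInvariantForest F) : GTree G where
  V := F.ConnectedComponent
  graph := T.collapseGraph F
  isTree := hF.collapseGraph_isTree
  len := fun _ => 1
  len_bound := fun _ => ⟨1, one_pos, fun _ _ => le_rfl⟩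
  act := fun c g => c.map (hF.hom hF g)
  act_one := fun c => by
    induction c using SimpleGraph.ConnectedComponent.ind with
    | h v => exact congrArg F.connectedComponentMk (T.act_one v)
  act_mul := fun c g h => by
    induction c using SimpleGraph.ConnectedComponent.ind with
    | h v => exact congrArg F.connectedComponentMk (T.act_mul v g h)
  act_adj := by
    rintro _ _ g ⟨hne, u, v, rfl, rfl, huv⟩
    refine ⟨fun h => hne ?_, T.act u g, T.act v g, rfl, rfl, T.act_adj u v g huv⟩
    exact SimpleGraph.ConnectedComponent.eq.2 ((hF.reachable_act_iff g).1
      (SimpleGraph.ConnectedComponent.eq.1 h))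
  act_len := fun _ _ _ _ => rfl
  no_inversion := by
    rintro _ _ g ⟨hne, u, v, rfl, rfl, huv⟩ ⟨h1, h2⟩
    have := hF.edge_unique huv (T.act_adj v u g huv.symm)
      (SimpleGraph.ConnectedComponent.eq.1 h2).symm (SimpleGraph.ConnectedComponent.eq.1 h1).symm
      fun h => hne (SimpleGraph.ConnectedComponent.eq.2 h)
    exact T.no_inversion u v g huv ⟨this.2.symm, this.1.symm⟩

namespace IsInvariantForest

variable {F : SimpleGraph T.V} (hF : T.IsInvariantForest F)

/-- The collapse map on vertices. -/
def toCollapse (v : T.V) : (T.collapse F hF).V := F.connectedComponentMk v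

theorem toCollapse_surjective : Function.Surjective hF.toCollapse := fun c =>
  c.exists_rep

theorem toCollapse_eq_iff {u v : T.V} : hF.toCollapse u = hF.toCollapse v ↔ F.Reachable u v :=
  SimpleGraph.ConnectedComponent.eq

theorem toCollapse_act (v : T.V) (g : G) :
    (T.collapse F hF).act (hF.toCollapse v) g = hF.toCollapse (T.act v g) := rfl

theorem collapse_adj_iff {c d : (T.collapse F hF).V} : (T.collapse F hF).graph.Adj c d ↔
    c ≠ d ∧ ∃ u v, hF.toCollapse u = c ∧ hF.toCollapse v = d ∧ T.graph.Adj u v := Iff.rfl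

theorem mem_stab_toCollapse {v : T.V} {g : G} :
    g ∈ (T.collapse F hF).stab (hF.toCollapse v) ↔ F.Reachable v (T.act v g) := by
  rw [mem_stab, toCollapse_act, toCollapse_eq_iff, SimpleGraph.reachable_comm]

theorem stab_le_stab_toCollapse (v : T.V) :
    T.stab v ≤ (T.collapse F hF).stab (hF.toCollapse v) := fun g hg => by
  rw [mem_stab, toCollapse_act, mem_stab.1 hg]

theorem collapse_isEdgeFree (hT : T.IsEdgeFree) : (T.collapse F hF).IsEdgeFree := by
  rintro c d g hadj he
  rcases Sym2.eq_iff.1 he with ⟨h1, h2⟩ | h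
  · obtain ⟨hne, u, v, rfl, rfl, huv⟩ := hF.collapse_adj_iff.1 hadj
    rw [toCollapse_act, toCollapse_eq_iff] at h1 h2
    rw [Ne, toCollapse_eq_iff] at hne
    obtain ⟨h3, h4⟩ := hF.edge_unique huv (T.act_adj u v g huv) h1.symm h2.symm hne
    exact hT u v g huv (by rw [← h3, ← h4])
  · exact absurd h ((T.collapse F hF).no_inversion c d g hadj)

theorem collapse_isCocompact (hT : T.IsCocompact) : (T.collapse F hF).IsCocompact := by
  obtain ⟨hV, hE⟩ := hT
  refine ⟨?_, ?_⟩
  · refine Finite.of_surjective (α := T.quotientGraph.V)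
      (Quotient.map (sa := T.vertexSetoid) (sb := (T.collapse F hF).vertexSetoid) hF.toCollapse ?_)
      ?_
    · rintro u v ⟨g, rfl⟩
      exact ⟨g, rfl⟩
    · intro q
      induction q using Quotient.inductionOn with
      | h c =>
        obtain ⟨v, rfl⟩ := hF.toCollapse_surjective c
        exact ⟨Quotient.mk _ v, rfl⟩
  · have hd : ∀ e : (T.collapse F hF).quotientGraph.E, ∃ (d : T.graph.Dart)
        (d' : (T.collapse F hF).graph.Dart), Quotient.mk (T.collapse F hF).dartSetoid d' = e ∧
          hF.toCollapse d.fst = d'.fst ∧ hF.toCollapse d.snd = d'.snd := by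
      intro e
      induction e using Quotient.inductionOn with
      | h d' =>
        obtain ⟨-, u, v, hu, hv, huv⟩ := hF.collapse_adj_iff.1 d'.adj
        exact ⟨⟨(u, v), huv⟩, d', rfl, hu, hv⟩
    choose d d' hd' h1 h2 using hd
    refine Finite.of_injective (β := T.quotientGraph.E)
      (fun e => Quotient.mk T.dartSetoid (d e)) fun e e' h => ?_
    obtain ⟨g, hg1, hg2⟩ := Quotient.exact (s := T.dartSetoid) h
    rw [← hd' e, ← hd' e']
    refine Quotient.sound (s := (T.collapse F hF).dartSetoid) ⟨g, ?_, ?_⟩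
    · rw [← h1, ← h1, toCollapse_act, hg1]
    · rw [← h2, ← h2, toCollapse_act, hg2]

theorem collapse_isMinimal (hT : T.IsMinimal) : (T.collapse F hF).IsMinimal := by
  intro K hK hinv
  -- The preimage of `K`: edges inside the collapsed components are included along with those lying
  -- over edges of `K`. It is an invariant subtree of `T`, hence everything.
  let K' : T.graph.Subgraph :=
    { verts := {v | hF.toCollapse v ∈ K.verts}
      Adj := fun u v => T.graph.Adj u v ∧ hF.toCollapse u ∈ K.verts ∧
        hF.toCollapse v ∈ K.verts ∧
          (F.Reachable u v ∨ K.Adj (hF.toCollapse u) (hF.toCollapse v))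
      adj_sub := fun h => h.1
      edge_vert := fun h => h.2.1
      symm := ⟨fun u v h => ⟨h.1.symm, h.2.2.1, h.2.1, h.2.2.2.imp SimpleGraph.Reachable.symm
        fun h => h.symm⟩⟩ }
  have hKtop : K' = ⊤ := by
    refine hT K' ?_ ?_
    · have hcomp : ∀ {u v : T.V} (hu : u ∈ K'.verts) (hv : v ∈ K'.verts), F.Reachable u v →
          K'.coe.Reachable ⟨u, hu⟩ ⟨v, hv⟩ := by
        rintro u v hu hv ⟨w⟩
        induction w with
        | nil => exact .refl _
        | @cons a b c hab _ ih =>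
          have heq : hF.toCollapse a = hF.toCollapse b := hF.toCollapse_eq_iff.2 hab.reachable
          have hb : b ∈ K'.verts := by
            change hF.toCollapse b ∈ K.verts
            rw [← heq]
            exact hu
          refine SimpleGraph.Reachable.trans ?_ (ih hb hv)
          exact SimpleGraph.Adj.reachable (G := K'.coe)
            (show K'.Adj a b from ⟨hF.le hab, hu, hb, Or.inl hab.reachable⟩)
      have hwalk : ∀ {c d : K.verts} (_ : K.coe.Walk c d) {u v : T.V} (hu : u ∈ K'.verts)
          (hv : v ∈ K'.verts), hF.toCollapse u = c → hF.toCollapse v = d →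
          K'.coe.Reachable ⟨u, hu⟩ ⟨v, hv⟩ := by
        intro c d w
        induction w with
        | nil =>
          intro u v hu hv h1 h2
          exact hcomp hu hv (hF.toCollapse_eq_iff.1 (h1.trans h2.symm))
        | @cons c d e hcd _ ih =>
          intro u v hu hv h1 h2
          have hcd' : K.Adj c d := hcd
          obtain ⟨-, x, y, hx, hy, hxy⟩ := hF.collapse_adj_iff.1 hcd'.adj_sub
          have hx' : x ∈ K'.verts := by
            change hF.toCollapse x ∈ K.verts
            rw [hx]
            exact c.2
          have hy' : y ∈ K'.verts := by
            change hF.toCollapse y ∈ K.verts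
            rw [hy]
            exact d.2
          refine (hcomp hu hx' (hF.toCollapse_eq_iff.1 (h1.trans hx.symm))).trans
            (SimpleGraph.Reachable.trans ?_ (ih hy' hv hy h2))
          exact SimpleGraph.Adj.reachable (G := K'.coe)
            (show K'.Adj x y from ⟨hxy, hx', hy', Or.inr (by rw [hx, hy]; exact hcd')⟩)
      obtain ⟨c, hc⟩ := hK.nonempty
      obtain ⟨v, rfl⟩ := hF.toCollapse_surjective c
      refine SimpleGraph.Subgraph.connected_iff.2 ⟨⟨fun x y => ?_⟩, ⟨v, hc⟩⟩
      obtain ⟨w⟩ := hK.coe.preconnected ⟨_, x.2⟩ ⟨_, y.2⟩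
      exact hwalk w x.2 y.2 rfl rfl
    · refine ⟨fun v hv g => hinv.1 _ hv g, fun u v h g => ⟨T.act_adj _ _ g h.1,
        hinv.1 _ h.2.1 g, hinv.1 _ h.2.2.1 g, h.2.2.2.imp (fun h => hF.reachable_act h g)
          fun h => hinv.2 (hF.toCollapse u) (hF.toCollapse v) h g⟩⟩
  have hverts : ∀ v, hF.toCollapse v ∈ K.verts := fun v => by
    have : v ∈ K'.verts := by rw [hKtop]; trivial
    exact this
  refine SimpleGraph.Subgraph.ext ?_ ?_
  · refine Set.eq_univ_of_forall fun c => ?_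
    obtain ⟨v, rfl⟩ := hF.toCollapse_surjective c
    exact hverts v
  · funext c d
    refine propext ⟨fun h => h.adj_sub, fun h => ?_⟩
    obtain ⟨hne, u, v, rfl, rfl, huv⟩ := hF.collapse_adj_iff.1 h
    have : K'.Adj u v := by rw [hKtop]; exact huv
    exact this.2.2.2.resolve_left fun hr => hne (hF.toCollapse_eq_iff.2 hr)

/-- In a minimal tree no component of a proper invariant forest is invariant. -/
theorem stab_toCollapse_ne_top (hT : T.IsMinimal) (hne : F ≠ T.graph) (v : T.V) :
    (T.collapse F hF).stab (hF.toCollapse v) ≠ ⊤ := by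
  intro htop
  have hinv : ∀ g, F.Reachable v (T.act v g) := fun g =>
    hF.mem_stab_toCollapse.1 (htop ▸ Subgroup.mem_top g)
  have hact : ∀ {w} g, F.Reachable v w → F.Reachable v (T.act w g) := fun g h =>
    (hinv g).trans (hF.reachable_act h g)
  -- The component of `v` as a subtree; if all of `G` stabilises it, minimality makes it the whole
  -- tree.
  let K : T.graph.Subgraph :=
    { verts := {w | F.Reachable v w}
      Adj := fun a b => F.Adj a b ∧ F.Reachable v a
      adj_sub := fun h => hF.le h.1
      edge_vert := fun h => h.2
      symm := ⟨fun a b h => ⟨h.1.symm, h.2.trans h.1.reachable⟩⟩ }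
  have hreach : ∀ {a b : T.V} (ha : a ∈ K.verts) (hb : b ∈ K.verts), F.Reachable a b →
      K.coe.Reachable ⟨a, ha⟩ ⟨b, hb⟩ := by
    rintro a b ha hb ⟨w⟩
    induction w with
    | nil => exact .refl _
    | @cons a b c hab _ ih =>
      refine SimpleGraph.Reachable.trans ?_
        (ih (show F.Reachable v b from SimpleGraph.Reachable.trans ha hab.reachable) hb)
      exact SimpleGraph.Adj.reachable (G := K.coe) (show K.Adj a b from ⟨hab, ha⟩)
  have hK : K = ⊤ := by
    refine hT K (SimpleGraph.Subgraph.connected_iff.2 ⟨⟨fun a b => ?_⟩, ⟨v, .refl _⟩⟩)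
      ⟨fun w hw g => hact g hw, fun a b h g => ⟨hF.adj g h.1, hact g h.2⟩⟩
    exact hreach a.2 b.2 (SimpleGraph.Reachable.trans (SimpleGraph.Reachable.symm a.2) b.2)
  refine hne (le_antisymm hF.le fun a b hab => ?_)
  have : K.Adj a b := by rw [hK]; exact hab
  exact this.1

end IsInvariantForest

/-! ### The edge module of an edge-free tree -/

/-- Representatives `d i` of the orbits of non-oriented edges: the translates of the oriented edges
`d i` by the elements of `G` are an orientation of the tree. -/
theorem IsEdgeFree.exists_orientation (hT : T.IsEdgeFree) (hfin : Finite T.quotientGraph.E) :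
    ∃ (ι : Type u) (_ : Finite ι) (d : ι → T.graph.Dart),
      (∀ u v, T.graph.Adj u v → ∃ i g, (T.act (d i).fst g = u ∧ T.act (d i).snd g = v) ∨
        (T.act (d i).fst g = v ∧ T.act (d i).snd g = u)) ∧
      ∀ i g j h, s(T.act (d i).fst g, T.act (d i).snd g) =
        s(T.act (d j).fst h, T.act (d j).snd h) → i = j ∧ g = h := by
  classical
  -- An arbitrary order selects one orientation of each edge orbit; the two orientations lie in
  -- different orbits because there are no inversions.
  let _ : LinearOrder T.quotientGraph.E := IsWellOrder.linearOrder WellOrderingRel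
  let ι := {e : T.quotientGraph.E // e < T.quotientGraph.inv e}
  choose d hd using fun i : ι => Quotient.exists_rep (s := T.dartSetoid) i.1
  refine ⟨ι, inferInstance, d, fun u v huv => ?_, fun i g j h he => ?_⟩
  · let e : T.quotientGraph.E := Quotient.mk T.dartSetoid ⟨(u, v), huv⟩
    rcases lt_or_gt_of_ne (T.quotientGraph.inv_ne e) with hlt | hlt
    · let i : ι := ⟨T.quotientGraph.inv e, by rwa [T.quotientGraph.inv_inv]⟩
      obtain ⟨g, h1, h2⟩ := Quotient.exact (s := T.dartSetoid)
        ((hd i).trans (rfl : _ = Quotient.mk T.dartSetoid ⟨(v, u), huv.symm⟩))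
      exact ⟨i, g, Or.inr ⟨h1, h2⟩⟩
    · obtain ⟨g, h1, h2⟩ := Quotient.exact (s := T.dartSetoid) (hd ⟨e, hlt⟩)
      exact ⟨⟨e, hlt⟩, g, Or.inl ⟨h1, h2⟩⟩
  · rcases Sym2.eq_iff.1 he with ⟨h1, h2⟩ | ⟨h1, h2⟩
    · have hij : i = j := by
        refine Subtype.ext ?_
        rw [← hd i, ← hd j]
        refine Quotient.sound (s := T.dartSetoid) ⟨g * h⁻¹, ?_, ?_⟩
        · rw [T.act_mul, h1, T.act_act_inv]
        · rw [T.act_mul, h2, T.act_act_inv]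
      subst hij
      refine ⟨rfl, mul_inv_eq_one.1 (hT _ _ (g * h⁻¹) (d i).adj ?_)⟩
      rw [T.act_mul, T.act_mul, h1, h2, T.act_act_inv, T.act_act_inv]
    · exfalso
      have hij : i.1 = T.quotientGraph.inv j.1 := by
        rw [← hd i, ← hd j]
        refine Quotient.sound (s := T.dartSetoid) ⟨g * h⁻¹, ?_, ?_⟩
        · rw [T.act_mul, h1, T.act_act_inv]
          rfl
        · rw [T.act_mul, h2, T.act_act_inv]
          rfl
      have hji : j.1 = T.quotientGraph.inv i.1 := by rw [hij, T.quotientGraph.inv_inv]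
      have h3 := i.2
      have h4 := j.2
      rw [← hij] at h4
      rw [← hji] at h3
      exact lt_asymm h3 h4

variable {ι : Type u} (d : ι → T.graph.Dart)

/-- The boundary map from the edge module to the vertex module. -/
noncomputable def boundary : (ι × G →₀ ℝ) →ₗ[ℝ] (T.V →₀ ℝ) :=
  Finsupp.linearCombination ℝ fun x =>
    Finsupp.single (T.act (d x.1).snd x.2) 1 - Finsupp.single (T.act (d x.1).fst x.2) 1

theorem boundary_single (x : ι × G) : boundary d (Finsupp.single x 1) =
    Finsupp.single (T.act (d x.1).snd x.2) 1 - Finsupp.single (T.act (d x.1).fst x.2) 1 := by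
  simp [boundary]

theorem boundary_injective (hd : ∀ i g j h, s(T.act (d i).fst g, T.act (d i).snd g) =
    s(T.act (d j).fst h, T.act (d j).snd h) → i = j ∧ g = h) :
    Function.Injective (boundary d) := by
  classical
  rw [injective_iff_map_eq_zero]
  intro m hm
  ext ⟨i, g⟩
  let p := T.act (d i).fst g
  let q := T.act (d i).snd g
  have hpq : T.graph.Adj p q := T.act_adj _ _ g (d i).adj
  -- The total weight on the far side of the edge `pq`. Of all edge boundaries only that of `pq`
  -- crosses the cut, so this functional recovers the coefficient of `pq`.
  let c : (T.V →₀ ℝ) →ₗ[ℝ] ℝ := Finsupp.linearCombination ℝ fun w =>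
    if (T.graph.deleteEdges {s(p, q)}).Reachable q w then (1 : ℝ) else 0
  have hc : c ∘ₗ boundary d = Finsupp.lapply (i, g) := by
    refine Finsupp.lhom_ext' fun x => LinearMap.ext_ring ?_
    obtain ⟨j, h⟩ := x
    simp only [LinearMap.comp_apply, Finsupp.lsingle_apply, boundary_single, map_sub, c,
      Finsupp.linearCombination_single, one_smul, Finsupp.lapply_apply]
    have hadj : T.graph.Adj (T.act (d j).fst h) (T.act (d j).snd h) := T.act_adj _ _ h (d j).adj
    by_cases he : s(T.act (d j).fst h, T.act (d j).snd h) = s(p, q)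
    · obtain ⟨rfl, rfl⟩ := hd _ _ _ _ he
      have hbr := SimpleGraph.isAcyclic_iff_forall_adj_isBridge.1 T.isTree.isAcyclic hpq
      rw [SimpleGraph.isBridge_iff, SimpleGraph.reachable_comm] at hbr
      rw [if_pos (SimpleGraph.Reachable.refl _), if_neg hbr]
      simp
    · have hne : (j, h) ≠ (i, g) := by
        rintro ⟨⟩
        exact he rfl
      simp only [SimpleGraph.reachable_deleteEdges_iff_of_adj hadj he, sub_self]
      rw [Finsupp.single_eq_of_ne hne.symm]
  have := LinearMap.congr_fun hc m
  simpa [hm] using this.symm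

/-- Differences of two vertices are boundaries, by telescoping along a walk, and they span the
augmentation kernel. -/
theorem mem_range_boundary (hd : ∀ u v, T.graph.Adj u v → ∃ i g,
    (T.act (d i).fst g = u ∧ T.act (d i).snd g = v) ∨
      (T.act (d i).fst g = v ∧ T.act (d i).snd g = u)) {m : T.V →₀ ℝ}
    (hm : Finsupp.linearCombination ℝ (fun _ => (1 : ℝ)) m = 0) :
    m ∈ LinearMap.range (boundary d) := by
  have hpair : ∀ u v : T.V, Finsupp.single u (1 : ℝ) - Finsupp.single v 1 ∈
      LinearMap.range (boundary d) := by
    intro u v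
    obtain ⟨w⟩ := T.isTree.connected.preconnected u v
    induction w with
    | nil => simp
    | @cons u w v huw _ ih =>
      rw [← sub_add_sub_cancel _ (Finsupp.single w 1)]
      refine add_mem ?_ ih
      obtain ⟨i, g, ⟨h1, h2⟩ | ⟨h1, h2⟩⟩ := hd u w huw
      · rw [← neg_sub]
        refine neg_mem ⟨Finsupp.single (i, g) 1, ?_⟩
        rw [boundary_single, h1, h2]
      · refine ⟨Finsupp.single (i, g) 1, ?_⟩
        rw [boundary_single, h1, h2]
  obtain ⟨v₀⟩ := T.isTree.connected.nonempty
  have key : ∀ m : T.V →₀ ℝ, m - Finsupp.single v₀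
      (Finsupp.linearCombination ℝ (fun _ => (1 : ℝ)) m) ∈ LinearMap.range (boundary d) := by
    intro m
    induction m using Finsupp.induction_linear with
    | zero => simp
    | add m n hm hn =>
      rw [map_add, Finsupp.single_add, add_sub_add_comm]
      exact add_mem hm hn
    | single v r =>
      have := Submodule.smul_mem _ r (hpair v v₀)
      simpa [smul_sub] using this
  simpa [hm] using key m

/-- A surjective twisted-equivariant map between the vertices of a cocompact edge-free tree is
injective. -/
theorem IsEdgeFree.injective_of_surjective (hT : T.IsEdgeFree) (hfin : Finite T.quotientGraph.E)
    (a : MulAut G) {ψ : T.V → T.V} (hψ : ∀ v g, ψ (T.act v g) = T.act (ψ v) (a g))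
    (hsurj : Function.Surjective ψ) : Function.Injective ψ := by
  obtain ⟨ι, hι, d, hd1, hd2⟩ := hT.exists_orientation hfin
  let Ψ : (T.V →₀ ℝ) →ₗ[ℝ] (T.V →₀ ℝ) := Finsupp.lmapDomain ℝ ℝ ψ
  let ε : (T.V →₀ ℝ) →ₗ[ℝ] ℝ := Finsupp.linearCombination ℝ fun _ => (1 : ℝ)
  have hεΨ : ∀ m, ε (Ψ m) = ε m := fun m => by
    have : ε ∘ₗ Ψ = ε := by
      refine Finsupp.lhom_ext' fun x => LinearMap.ext_ring ?_
      simp [ε, Ψ, Finsupp.mapDomain_single]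
    exact LinearMap.congr_fun this m
  have hε : ∀ m, ε (boundary d m) = 0 := fun m => by
    have : ε ∘ₗ boundary d = 0 := by
      refine Finsupp.lhom_ext' fun x => LinearMap.ext_ring ?_
      simp [ε, boundary_single]
    exact LinearMap.congr_fun this m
  have hinj := boundary_injective d hd2
  -- Precomposing with `a⁻¹` on the group coordinate cancels the twist of `ψ`, so that the
  -- endomorphism `A` of the edge module below is genuinely equivariant.
  let τ : ι × G ≃ ι × G := (Equiv.refl ι).prodCongr a.symm.toEquiv
  have hlift : ∀ x : ι × G, ∃ y, boundary d y = Ψ (boundary d (Finsupp.single (τ x) 1)) :=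
    fun x => mem_range_boundary d hd1 (by
      change ε _ = 0
      rw [hεΨ, hε])
  choose y hy using hlift
  let A : (ι × G →₀ ℝ) →ₗ[ℝ] (ι × G →₀ ℝ) := Finsupp.linearCombination ℝ y
  have hAs : ∀ x, A (Finsupp.single x 1) = y x := fun x => by simp [A]
  have hA : ∀ m, boundary d (A m) = Ψ (boundary d (m.mapDomain τ)) := fun m => by
    have : boundary d ∘ₗ A = Ψ ∘ₗ boundary d ∘ₗ Finsupp.lmapDomain ℝ ℝ τ := by
      refine Finsupp.lhom_ext' fun x => LinearMap.ext_ring ?_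
      simp [hAs, hy, Finsupp.mapDomain_single]
    exact LinearMap.congr_fun this m
  have hbd : ∀ h m, boundary d (m.mapDomain (rightTranslation ι h)) =
      (boundary d m).mapDomain fun v => T.act v h := fun h m => by
    have : boundary d ∘ₗ Finsupp.lmapDomain ℝ ℝ (rightTranslation ι h) =
        Finsupp.lmapDomain ℝ ℝ (fun v => T.act v h) ∘ₗ boundary d := by
      refine Finsupp.lhom_ext' fun x => LinearMap.ext_ring ?_
      obtain ⟨i, g⟩ := x
      simp only [LinearMap.comp_apply, Finsupp.lsingle_apply, Finsupp.lmapDomain_apply,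
        Finsupp.mapDomain_single, rightTranslation_apply, boundary_single, T.act_mul]
      rw [← Finsupp.lmapDomain_apply ℝ ℝ, map_sub]
      simp [Finsupp.mapDomain_single]
    exact LinearMap.congr_fun this m
  have hEq : IsEquivariant A := by
    refine isEquivariant_of_single fun h x => hinj ?_
    rw [hbd, hA, hA, Finsupp.mapDomain_single, Finsupp.mapDomain_single]
    have h1 : τ (rightTranslation ι h x) = rightTranslation ι (a.symm h) (τ x) := by
      obtain ⟨i, g⟩ := x
      simp [τ]
    rw [h1, ← Finsupp.mapDomain_single, hbd]
    simp only [Ψ, Finsupp.lmapDomain_apply, ← Finsupp.mapDomain_comp]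
    congr 1
    funext v
    simp [hψ]
  -- `Ψ` preserves the augmentation, so any preimage of a boundary under `Ψ` has augmentation `0`
  -- and is itself a boundary.
  have hAsurj : Function.Surjective A := fun z => by
    obtain ⟨m, hm⟩ := Finsupp.mapDomain_surjective (M := ℝ) hsurj (boundary d z)
    have h0 : ε m = 0 := by rw [← hεΨ, show Ψ m = boundary d z from hm, hε]
    obtain ⟨n, hn⟩ := mem_range_boundary d hd1 h0
    refine ⟨n.mapDomain τ.symm, hinj ?_⟩
    rw [hA, ← Finsupp.mapDomain_comp, τ.self_comp_symm, Finsupp.mapDomain_id, hn]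
    exact hm
  have hAinj := hEq.injective_of_surjective hAsurj
  -- If `ψ` identifies `u` and `v`, then `u - v` is a boundary killed by `Ψ`, so its coefficient
  -- vector vanishes.
  intro u v huv
  have h0 : ε (Finsupp.single u 1 - Finsupp.single v 1) = 0 := by simp [ε]
  obtain ⟨m, hm⟩ := mem_range_boundary d hd1 h0
  have hm0 : m.mapDomain τ.symm = 0 := hAinj (hinj (by
    rw [hA, ← Finsupp.mapDomain_comp, τ.self_comp_symm, Finsupp.mapDomain_id, hm, map_zero,
      map_zero, map_sub]
    simp [Ψ, Finsupp.mapDomain_single, huv]))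
  have hm1 : m = 0 := Finsupp.mapDomain_injective τ.symm.injective (by
    rw [hm0, Finsupp.mapDomain_zero])
  rw [hm1, map_zero] at hm
  exact Finsupp.single_left_injective one_ne_zero (sub_eq_zero.1 hm.symm)

/-! ### Invariance of the set of elliptic subgroups -/

theorem act_eq_act_iff {v : T.V} (hv : T.stab v = ⊥) {g h : G} :
    T.act v g = T.act v h ↔ g = h := by
  refine ⟨fun e => ?_, fun e => by rw [e]⟩
  have : g * h⁻¹ ∈ T.stab v := by rw [mem_stab, T.act_mul, e, T.act_act_inv]
  rw [hv, Subgroup.mem_bot] at this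
  exact mul_inv_eq_one.1 this

theorem stab_act_eq_bot {v : T.V} (hv : T.stab v = ⊥) (g : G) : T.stab (T.act v g) = ⊥ := by
  rw [eq_bot_iff]
  intro h hh
  rw [mem_stab, ← T.act_mul, act_eq_act_iff hv, mul_eq_left] at hh
  exact hh

theorem stab_act_eq_bot_iff {v : T.V} (g : G) : T.stab (T.act v g) = ⊥ ↔ T.stab v = ⊥ := by
  refine ⟨fun h => ?_, fun h => stab_act_eq_bot h g⟩
  simpa [T.act_act_inv] using stab_act_eq_bot h g⁻¹

/-- The set of vertices with trivial stabiliser has a twisted-equivariant self-surjection. -/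
theorem exists_twisted_surjection (T : GTree G) (a : MulAut G) : ∃ ψ : T.V → T.V,
    (∀ v, T.stab v = ⊥ → ∀ g, ψ (T.act v g) = T.act (ψ v) (a g)) ∧
      ∀ v, T.stab v = ⊥ → ∃ w, T.stab w = ⊥ ∧ ψ w = v := by
  let rep : T.V → T.V := fun v => (Quotient.mk T.vertexSetoid v).out
  have hrep : ∀ v, ∃ g, T.act (rep v) g = v := fun v =>
    Quotient.mk_out (s := T.vertexSetoid) v
  have hrep_act : ∀ v g, rep (T.act v g) = rep v := fun v g =>
    congrArg Quotient.out (Quotient.sound (s := T.vertexSetoid) ⟨g, rfl⟩).symm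
  choose k hk using hrep
  have hfree : ∀ v, T.stab v = ⊥ → T.stab (rep v) = ⊥ := fun v hv => by
    rwa [← stab_act_eq_bot_iff (k v), hk]
  -- On a free orbit with base point `r` this is the map `r · g ↦ r · a(g)`, which is well defined
  -- because `k` is then determined by the vertex.
  refine ⟨fun v => T.act (rep v) (a (k v)), fun v hv g => ?_, fun v hv => ?_⟩
  · have : k (T.act v g) = k v * g := by
      rw [← act_eq_act_iff (hfree v hv), T.act_mul, hk, ← hrep_act v g, hk]
    beta_reduce
    rw [hrep_act, this, map_mul, T.act_mul]
  · let w := T.act (rep v) (a⁻¹ (k v))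
    have hw : rep w = rep v := by
      have h1 := hrep_act (rep v) (a⁻¹ (k v))
      have h2 := hrep_act (rep v) (k v)
      rw [hk] at h2
      exact h1.trans h2.symm
    have hkw : k w = a⁻¹ (k v) := by
      rw [← act_eq_act_iff (hfree v hv), ← hw, hk, hw]
    refine ⟨w, stab_act_eq_bot (hfree v hv) _, ?_⟩
    beta_reduce
    rw [hw, hkw, MulAut.apply_inv_self, hk]

/-- If a twisted-equivariant self-map of the vertices of a cocompact edge-free tree is surjective
onto the vertices with non-trivial stabiliser, then the automorphism preserves the set of elliptic
subgroups. -/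
theorem IsEdgeFree.mem_autPreserving (hT : T.IsEdgeFree) (hfin : Finite T.quotientGraph.E)
    (a : MulAut G) {ψ : T.V → T.V} (hψ : ∀ v g, ψ (T.act v g) = T.act (ψ v) (a g))
    (hsurj : ∀ v, T.stab v ≠ ⊥ → ∃ w, T.stab w ≠ ⊥ ∧ ψ w = v) :
    a ∈ autPreserving T.ellipticSubgroups := by
  classical
  obtain ⟨χ, hχ, hχs⟩ := T.exists_twisted_surjection a
  -- Values of `ψ` at free vertices are discarded, which is why `hsurj` asks for preimages with
  -- non-trivial stabiliser.
  let θ : T.V → T.V := fun v => if T.stab v = ⊥ then χ v else ψ v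
  have hθ : ∀ v g, θ (T.act v g) = T.act (θ v) (a g) := fun v g => by
    by_cases hv : T.stab v = ⊥
    · simp only [θ, stab_act_eq_bot_iff, hv, if_true, hχ v hv]
    · simp only [θ, stab_act_eq_bot_iff, hv, if_false, hψ]
  have hθs : Function.Surjective θ := fun v => by
    by_cases hv : T.stab v = ⊥
    · obtain ⟨w, hw, rfl⟩ := hχs v hv
      exact ⟨w, if_pos hw⟩
    · obtain ⟨w, hw, rfl⟩ := hsurj v hv
      exact ⟨w, if_neg hw⟩
  have hθi := hT.injective_of_surjective hfin a hθ hθs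
  change _ '' _ = _
  refine Set.Subset.antisymm ?_ ?_
  · rintro _ ⟨H, hH, rfl⟩
    obtain ⟨v, hv⟩ := mem_ellipticSubgroups.1 hH
    refine mem_ellipticSubgroups.2 ⟨θ v, ?_⟩
    rintro _ ⟨g, hg, rfl⟩
    refine (hθ v g).symm.trans ?_
    rw [mem_stab.1 (hv hg)]
  · intro H hH
    obtain ⟨v, hv⟩ := mem_ellipticSubgroups.1 hH
    obtain ⟨w, rfl⟩ := hθs v
    -- Injectivity of `θ` enters here: if `a g` fixes `θ w`, then `g` fixes `w`.
    refine ⟨H.comap a.toMonoidHom, mem_ellipticSubgroups.2 ⟨w, fun g hg => hθi ?_⟩,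
      Subgroup.map_comap_eq_self_of_surjective a.surjective H⟩
    rw [hθ]
    exact hv hg

theorem conj_mem_autPreserving (T : GTree G) (g : G) :
    MulAut.conj g ∈ autPreserving T.ellipticSubgroups := by
  have key : ∀ (g : G), ∀ H ∈ T.ellipticSubgroups,
      H.map (MulAut.conj g).toMonoidHom ∈ T.ellipticSubgroups := by
    intro g H hH
    obtain ⟨v, hv⟩ := mem_ellipticSubgroups.1 hH
    refine mem_ellipticSubgroups.2 ⟨T.act v g⁻¹, ?_⟩
    rintro _ ⟨x, hx, rfl⟩
    change T.act (T.act v g⁻¹) (g * x * g⁻¹) = _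
    rw [T.act_mul, T.act_mul, T.act_inv_act, mem_stab.1 (hv hx)]
  change _ '' _ = _
  refine Set.Subset.antisymm ?_ fun H hH => ⟨_, key g⁻¹ H hH, ?_⟩
  · rintro _ ⟨H, hH, rfl⟩
    exact key g H hH
  · refine (Subgroup.map_map _ _ _).trans ?_
    convert Subgroup.map_id H using 2
    ext x
    simp [mul_assoc]

theorem mem_autPreserving_of_mem_outPreserving (T : GTree G) {a : MulAut G}
    (ha : (QuotientGroup.mk a : Out G) ∈ OutPreserving T.ellipticSubgroups) :
    a ∈ autPreserving T.ellipticSubgroups := by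
  obtain ⟨b, hb, hba⟩ := ha
  obtain ⟨g, hg⟩ := QuotientGroup.eq.1
    (show (QuotientGroup.mk b : Out G) = QuotientGroup.mk a from hba)
  have : a = b * MulAut.conj g := by rw [hg, mul_inv_cancel_left]
  rw [this]
  exact mul_mem hb (T.conj_mem_autPreserving g)

/-! ### Hyperbolic components -/

/-- The stabiliser of the component of `v` in the spanning subforest `F` fixes no vertex. -/
def IsHyperbolicAt (T : GTree G) (F : SimpleGraph T.V) (v : T.V) : Prop :=
  ∀ w, ∃ g, F.Reachable v (T.act v g) ∧ T.act w g ≠ w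

/-- A map of the vertices maps every component of a forest to a component. -/
def PreservesComponents (F : SimpleGraph T.V) (φ : T.V → T.V) : Prop :=
  ∀ u v, F.Adj u v → F.Reachable (φ u) (φ v)

theorem PreservesComponents.reachable {F : SimpleGraph T.V} {φ : T.V → T.V}
    (h : T.PreservesComponents F φ) {u v : T.V} (huv : F.Reachable u v) :
    F.Reachable (φ u) (φ v) := by
  obtain ⟨w⟩ := huv
  induction w with
  | nil => exact .refl _
  | cons hab _ ih => exact (h _ _ hab).trans ih

namespace IsInvariantForest

variable {F : SimpleGraph T.V} (hF : T.IsInvariantForest F)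

include hF

theorem isHyperbolicAt_iff {v : T.V} : T.IsHyperbolicAt F v ↔
    (T.collapse F hF).stab (hF.toCollapse v) ∉ T.ellipticSubgroups := by
  rw [mem_ellipticSubgroups, not_exists]
  refine forall_congr' fun w => ?_
  rw [SetLike.not_le_iff_exists]
  refine exists_congr fun g => ?_
  rw [hF.mem_stab_toCollapse, mem_stab]

theorem isHyperbolicAt_act {v : T.V} (h : T.IsHyperbolicAt F v) (g : G) :
    T.IsHyperbolicAt F (T.act v g) := by
  intro w
  obtain ⟨k, hk, hne⟩ := h (T.act w g⁻¹)
  refine ⟨g⁻¹ * k * g, ?_, fun he => hne ?_⟩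
  · rw [T.act_mul, T.act_mul, T.act_act_inv]
    exact hF.reachable_act hk g
  · rw [T.act_mul, T.act_mul] at he
    rw [← T.act_act_inv (T.act (T.act w g⁻¹) k) g, he]

theorem isHyperbolicAt_congr {u v : T.V} (huv : F.Reachable u v) (h : T.IsHyperbolicAt F u) :
    T.IsHyperbolicAt F v := fun w => by
  obtain ⟨g, hg, hne⟩ := h w
  exact ⟨g, huv.symm.trans (hg.trans (hF.reachable_act huv g)), hne⟩

/-- Were the stabiliser of the image component elliptic, it would be `a(L)` with `L` elliptic by
invariance of the system. But `L` contains the stabiliser of the original component, which fixes no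
vertex. -/
theorem isHyperbolicAt_map {a : MulAut G} (ha : a ∈ autPreserving T.ellipticSubgroups)
    {φ : T.V → T.V} (hφ : ∀ v g, φ (T.act v g) = T.act (φ v) (a g))
    (hφF : T.PreservesComponents F φ) {v : T.V} (h : T.IsHyperbolicAt F v) :
    T.IsHyperbolicAt F (φ v) := by
  rw [hF.isHyperbolicAt_iff]
  intro hell
  rw [← show _ '' _ = T.ellipticSubgroups from ha] at hell
  obtain ⟨L, hL, hLeq⟩ := hell
  obtain ⟨w, hw⟩ := mem_ellipticSubgroups.1 hL
  obtain ⟨g, hg, hne⟩ := h w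
  have hmem : a g ∈ (T.collapse F hF).stab (hF.toCollapse (φ v)) := by
    rw [hF.mem_stab_toCollapse, ← hφ]
    exact hφF.reachable hg
  rw [← hLeq] at hmem
  obtain ⟨l, hl, hla⟩ := hmem
  rw [a.injective hla] at hl
  exact hne (hw hl)

end IsInvariantForest

/-- The union of the components that contain an image of a hyperbolic component. -/
def hyperbolicImage (F : SimpleGraph T.V) (φ : T.V → T.V) : SimpleGraph T.V where
  Adj u v := F.Adj u v ∧ ∃ w, T.IsHyperbolicAt F w ∧ F.Reachable (φ w) u
  symm := ⟨fun _ _ ⟨h, w, hw, hr⟩ => ⟨h.symm, w, hw, hr.trans h.reachable⟩⟩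
  loopless := ⟨fun _ h => h.1.ne rfl⟩

theorem hyperbolicImage_le (F : SimpleGraph T.V) (φ : T.V → T.V) :
    T.hyperbolicImage F φ ≤ F := fun _ _ h => h.1

theorem reachable_hyperbolicImage {F : SimpleGraph T.V} {φ : T.V → T.V} {u v w : T.V}
    (hw : T.IsHyperbolicAt F w) (hr : F.Reachable (φ w) u) (huv : F.Reachable u v) :
    (T.hyperbolicImage F φ).Reachable u v := by
  obtain ⟨p⟩ := huv
  induction p with
  | nil => exact .refl _
  | @cons a b c hab _ ih =>
    have h1 : (T.hyperbolicImage F φ).Adj a b := ⟨hab, w, hw, hr⟩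
    exact h1.reachable.trans (ih (hr.trans hab.reachable))

/-! ### Minimal hyperbolic forests and the reduction. -/

/-- An invariant spanning subforest that is preserved by `φ` and has a hyperbolic component. -/
structure IsHyperbolicForest (T : GTree G) (φ : T.V → T.V) (F : SimpleGraph T.V) : Prop where
  invariant : T.IsInvariantForest F
  preserves : T.PreservesComponents F φ
  hyperbolic : ∃ v, T.IsHyperbolicAt F v

/-- Images of hyperbolic components are again hyperbolic, so every retained component is hyperbolic
and is sent to a retained one. -/
theorem IsHyperbolicForest.hyperbolicImage {a : MulAut G}
    (ha : a ∈ autPreserving T.ellipticSubgroups) {φ : T.V → T.V}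
    (hφ : ∀ v g, φ (T.act v g) = T.act (φ v) (a g)) {F : SimpleGraph T.V}
    (hF : T.IsHyperbolicForest φ F) : T.IsHyperbolicForest φ (T.hyperbolicImage F φ) := by
  obtain ⟨hinv, hpres, v, hv⟩ := hF
  refine ⟨⟨(hyperbolicImage_le F φ).trans hinv.le, ?_⟩, ?_, φ v, fun w => ?_⟩
  · rintro x y g ⟨hxy, w, hw, hr⟩
    refine ⟨hinv.adj g hxy, T.act w (a⁻¹ g), hinv.isHyperbolicAt_act hw _, ?_⟩
    rw [hφ, MulAut.apply_inv_self]
    exact hinv.reachable_act hr g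
  · rintro x y ⟨hxy, w, hw, hr⟩
    exact reachable_hyperbolicImage
      (hinv.isHyperbolicAt_congr hr (hinv.isHyperbolicAt_map ha hφ hpres hw))
      (.refl _) (hpres _ _ hxy)
  · obtain ⟨g, hg, hne⟩ := hinv.isHyperbolicAt_map ha hφ hpres hv w
    exact ⟨g, reachable_hyperbolicImage hv (.refl _) hg, hne⟩

/-- An invariant forest is determined by the set of edge orbits that it contains. -/
theorem finite_invariantForests (hfin : Finite T.quotientGraph.E) :
    {F : SimpleGraph T.V | T.IsInvariantForest F}.Finite := by
  let c : SimpleGraph T.V → Set T.quotientGraph.E := fun F =>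
    {e | ∃ d : T.graph.Dart, Quotient.mk T.dartSetoid d = e ∧ F.Adj d.fst d.snd}
  refine Set.Finite.of_finite_image (f := c) (Set.toFinite _) ?_
  have key : ∀ F F', T.IsInvariantForest F → T.IsInvariantForest F' → c F = c F' → F ≤ F' := by
    intro F F' hF hF' h u v huv
    have hmem : Quotient.mk T.dartSetoid ⟨(u, v), hF.le huv⟩ ∈ c F := ⟨_, rfl, huv⟩
    rw [h] at hmem
    obtain ⟨d, hd, hadj⟩ := hmem
    obtain ⟨g, h1, h2⟩ := Quotient.exact (s := T.dartSetoid) hd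
    have := hF'.adj g hadj
    rwa [h1, h2] at this
  exact fun F hF F' hF' h => le_antisymm (key F F' hF hF' h) (key F' F hF' hF h.symm)

/-- If the hyperbolic forest `F` is the union of the images of its hyperbolic components, then the
automorphism preserves the set of elliptic subgroups of the collapsed tree. -/
theorem IsHyperbolicForest.mem_autPreserving (hT : T.IsEdgeFree) (hco : T.IsCocompact)
    {a : MulAut G} (ha : a ∈ autPreserving T.ellipticSubgroups) {φ : T.V → T.V}
    (hφ : ∀ v g, φ (T.act v g) = T.act (φ v) (a g)) {F : SimpleGraph T.V}
    (hF : T.IsHyperbolicForest φ F) (himage : T.hyperbolicImage F φ = F) :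
    a ∈ autPreserving (T.collapse F hF.invariant).ellipticSubgroups := by
  have hinv := hF.invariant
  let ψ : (T.collapse F hinv).V → (T.collapse F hinv).V :=
    Quot.map φ fun _ _ h => hF.preserves.reachable h
  have hψ : ∀ v, ψ (hinv.toCollapse v) = hinv.toCollapse (φ v) := fun _ => rfl
  refine (hinv.collapse_isEdgeFree hT).mem_autPreserving (hinv.collapse_isCocompact hco).2 a
    (ψ := ψ) (fun c g => ?_) fun c hc => ?_
  · obtain ⟨v, rfl⟩ := hinv.toCollapse_surjective c
    rw [hinv.toCollapse_act, hψ, hψ, hφ, hinv.toCollapse_act]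
  · obtain ⟨v, rfl⟩ := hinv.toCollapse_surjective c
    obtain ⟨⟨g, hg⟩, hgne⟩ := Subgroup.ne_bot_iff_exists_ne_one.1 hc
    have hg1 : g ≠ 1 := fun h => hgne (Subtype.ext h)
    rw [hinv.mem_stab_toCollapse] at hg
    -- A component with an edge receives the image of a hyperbolic component by `himage`. A
    -- one-vertex component needs the invariance of the original elliptic system instead.
    by_cases hv : ∃ v', F.Adj v v'
    · obtain ⟨v', hv'⟩ := hv
      rw [← himage] at hv'
      obtain ⟨-, w, hw, hr⟩ := hv'
      refine ⟨hinv.toCollapse w, fun hbot => ?_, hinv.toCollapse_eq_iff.2 hr⟩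
      obtain ⟨k, hk, hne⟩ := hw w
      rw [← hinv.mem_stab_toCollapse, hbot, Subgroup.mem_bot] at hk
      exact hne (by rw [hk, T.act_one])
    · have hfix : T.act v g = v := by
        generalize T.act v g = x at hg
        obtain ⟨p⟩ := hg
        cases p with
        | nil => rfl
        | cons h _ => exact absurd ⟨_, h⟩ hv
      have hell : T.stab v ∈ T.ellipticSubgroups := mem_ellipticSubgroups.2 ⟨v, le_rfl⟩
      rw [← show _ '' _ = T.ellipticSubgroups from ha] at hell
      obtain ⟨L, hL, hLeq⟩ := hell
      obtain ⟨w, hw⟩ := mem_ellipticSubgroups.1 hL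
      have hmem : g ∈ T.stab v := hfix
      rw [← hLeq] at hmem
      obtain ⟨l, hl, rfl⟩ := hmem
      have hlw : T.act w l = w := hw hl
      -- The non-trivial element `a l` fixes both `φ w` and `v`, and it has at most one fixed
      -- vertex.
      have hφw : φ w = v := hT.eq_of_act_eq hg1 ((hφ w l).symm.trans (by rw [hlw])) hfix
      refine ⟨hinv.toCollapse w, fun hbot => hg1 ?_, by rw [hψ, hφw]⟩
      have := hinv.stab_le_stab_toCollapse w hlw
      rw [hbot, Subgroup.mem_bot] at this
      rw [this]
      exact map_one a

/-- A proper hyperbolic forest that is preserved by a representative of `α` gives a reduction. -/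
theorem isReducible_of_isHyperbolicForest {𝒢 : Set (Subgroup G)} (hT : T.InDeformationSpace 𝒢)
    {a : MulAut G} (hα : (QuotientGroup.mk a : Out G) ∈ OutPreserving 𝒢)
    {φ : T.V → T.V} (hφ : ∀ v g, φ (T.act v g) = T.act (φ v) (a g)) {F₀ : SimpleGraph T.V}
    (hF₀ : T.IsHyperbolicForest φ F₀) (hne : F₀ ≠ T.graph) :
    IsReducible 𝒢 (QuotientGroup.mk a : Out G) := by
  obtain ⟨hmin, hco, hfree, rfl⟩ := hT
  have ha := T.mem_autPreserving_of_mem_outPreserving hα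
  obtain ⟨F, hFmin⟩ := Set.Finite.exists_minimal
    (s := {F : SimpleGraph T.V | T.IsHyperbolicForest φ F ∧ F ≤ F₀})
    ((finite_invariantForests hco.2).subset fun F hF => hF.1.invariant) ⟨F₀, hF₀, le_rfl⟩
  obtain ⟨hF, hle⟩ := hFmin.prop
  have himage : T.hyperbolicImage F φ = F := hFmin.eq_of_le
    ⟨hF.hyperbolicImage ha hφ, (hyperbolicImage_le F φ).trans hle⟩ (hyperbolicImage_le F φ)
  have hinv := hF.invariant
  have hFne : F ≠ T.graph := fun h => hne (le_antisymm hF₀.invariant.le (h ▸ hle))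
  intro hmax
  have hℋ : (T.collapse F hinv).ellipticSubgroups ⊆ T.ellipticSubgroups := by
    refine hmax.le_of_ge ⟨⟨_, hinv.collapse_isMinimal hmin, hinv.collapse_isCocompact hco,
      hinv.collapse_isEdgeFree hfree, rfl⟩, ?_, a,
      hF.mem_autPreserving hfree hco ha hφ himage, rfl⟩ ?_
    · intro htop
      obtain ⟨c, hc⟩ := mem_ellipticSubgroups.1 htop
      obtain ⟨v, rfl⟩ := hinv.toCollapse_surjective c
      exact hinv.stab_toCollapse_ne_top hmin hFne v (top_le_iff.1 hc)
    · intro H hH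
      obtain ⟨v, hv⟩ := mem_ellipticSubgroups.1 hH
      exact mem_ellipticSubgroups.2 ⟨_, hv.trans (hinv.stab_le_stab_toCollapse v)⟩
  obtain ⟨v, hv⟩ := hF.hyperbolic
  exact hinv.isHyperbolicAt_iff.1 hv (hℋ (mem_ellipticSubgroups.2 ⟨_, le_rfl⟩))

/-! ### Invariant subforests and subgraphs of the quotient -/

theorem spanningCoe_reachable {F : T.graph.Subgraph} {x y : F.verts} (h : F.coe.Reachable x y) :
    F.spanningCoe.Reachable (x : T.V) (y : T.V) := by
  obtain ⟨w⟩ := h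
  induction w with
  | nil => exact .refl _
  | cons hab _ ih => exact SimpleGraph.Reachable.trans (SimpleGraph.Adj.reachable hab) ih

theorem componentVerts_mk {F : T.graph.Subgraph} {v : T.V} (hv : v ∈ F.verts) :
    T.componentVerts F (F.coe.connectedComponentMk ⟨v, hv⟩) =
      {w | F.spanningCoe.Reachable v w} := by
  ext w
  constructor
  · rintro ⟨x, hx, rfl⟩
    exact (spanningCoe_reachable (SimpleGraph.ConnectedComponent.exact hx)).symm
  · rintro ⟨p⟩
    suffices h : ∀ {u w : T.V} (_ : F.spanningCoe.Walk u w) (hu : u ∈ F.verts),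
        ∃ hw : w ∈ F.verts, F.coe.Reachable ⟨u, hu⟩ ⟨w, hw⟩ by
      obtain ⟨hw, hr⟩ := h p hv
      exact ⟨⟨w, hw⟩, SimpleGraph.ConnectedComponent.sound hr.symm, rfl⟩
    intro u w p
    induction p with
    | nil => exact fun hu => ⟨hu, .refl _⟩
    | @cons a b c hab _ ih =>
      intro hu
      have hab' : F.Adj a b := hab
      obtain ⟨hw, hr⟩ := ih hab'.snd_mem
      exact ⟨hw, SimpleGraph.Reachable.trans
        (SimpleGraph.Adj.reachable (G := F.coe)
          (show F.coe.Adj ⟨a, hu⟩ ⟨b, hab'.snd_mem⟩ from hab')) hr⟩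

theorem Invariant.isInvariantForest {F : T.graph.Subgraph} (hF : T.Invariant F) :
    T.IsInvariantForest F.spanningCoe := ⟨F.spanningCoe_le, fun g h => hF.2 _ _ h g⟩

/-- The setwise stabiliser of a component. -/
theorem setStabilizer_componentVerts {F : T.graph.Subgraph} (hF : T.Invariant F) {v : T.V}
    (hv : v ∈ F.verts) :
    T.setStabilizer (T.componentVerts F (F.coe.connectedComponentMk ⟨v, hv⟩)) =
      (T.collapse F.spanningCoe hF.isInvariantForest).stab (hF.isInvariantForest.toCollapse v) := by
  ext g
  rw [componentVerts_mk, hF.isInvariantForest.mem_stab_toCollapse]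
  refine ⟨fun hg => (hg v).1 (.refl _), fun hg w => ?_⟩
  change F.spanningCoe.Reachable _ _ ↔ F.spanningCoe.Reachable _ _
  rw [← hF.isInvariantForest.reachable_act_iff g]
  exact ⟨fun h => hg.trans h, fun h => hg.symm.trans h⟩

theorem mem_ellipticSubgroups_of_le {H K : Subgroup G} (h : H ≤ K)
    (hK : K ∈ T.ellipticSubgroups) : H ∈ T.ellipticSubgroups := by
  obtain ⟨v, hv⟩ := mem_ellipticSubgroups.1 hK
  exact mem_ellipticSubgroups.2 ⟨v, h.trans hv⟩

/-- A proper invariant hyperbolic subforest gives a reduction. -/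
theorem isReducible_of_subforest {𝒢 : Set (Subgroup G)} (hproper : IsProper 𝒢)
    (hT : T.InDeformationSpace 𝒢) {a : MulAut G}
    (hα : (QuotientGroup.mk a : Out G) ∈ OutPreserving 𝒢) {f : T.Point → (T.twist a).Point}
    (hf : T.Represents a f) (hsimp : MetricTree.IsSimplicial f) {F : T.graph.Subgraph}
    (hne : F ≠ ⊤) (hmaps : Set.MapsTo f (MetricTree.carrier F) (MetricTree.carrier F))
    (hinv : T.Invariant F) (hhyp : T.ForestHyperbolic 𝒢 F) :
    IsReducible 𝒢 (QuotientGroup.mk a : Out G) := by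
  choose φ' hφ using hsimp
  let φ : T.V → T.V := φ'
  have hφ' : ∀ v, f (T.vertexPoint v) = T.vertexPoint (φ v) := hφ
  have hφact : ∀ v g, φ (T.act v g) = T.act (φ v) (a g) := fun v g => by
    apply MetricTree.vertexPoint_injective
    refine (hφ' _).symm.trans ?_
    rw [← actPoint_vertexPoint]
    refine (hf.1.1 _ g).trans ?_
    rw [hφ]
    exact actPoint_vertexPoint (T := T.twist a) (φ v) g
  have hell := hT.2.2.2
  refine isReducible_of_isHyperbolicForest hT hα hφact (F₀ := F.spanningCoe)
    ⟨hinv.isInvariantForest, ?_, ?_⟩ ?_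
  · exact fun u v huv => MetricTree.reachable_of_mapsTo_carrier (M := T.toMetricTree) hf.1.2
      hmaps huv (hφ' u) (hφ' v)
  · rw [ForestHyperbolic, ForestElliptic, not_forall] at hhyp
    obtain ⟨A, hA⟩ := hhyp
    obtain ⟨v, rfl⟩ := A.exists_rep
    refine ⟨v, hinv.isInvariantForest.isHyperbolicAt_iff.2 ?_⟩
    rw [← setStabilizer_componentVerts hinv v.2, hell]
    exact hA
  · intro htop
    have hadj : ∀ {u v}, T.graph.Adj u v → F.Adj u v := fun {u v} h => by
      rw [← htop] at h
      exact h
    have hverts : ∀ v, v ∈ F.verts := fun v => by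
      by_contra hv
      -- Here all edges of `T` lie in `F` but the vertex `v` does not. Then `v` has no neighbours,
      -- `T` is a single vertex, and `G` is elliptic.
      refine hproper ?_
      rw [← hell]
      refine mem_ellipticSubgroups.2 ⟨v, fun g _ => ?_⟩
      obtain ⟨p⟩ := T.isTree.connected.preconnected v (T.act v g)
      rw [mem_stab]
      generalize T.act v g = x at p
      cases p with
      | nil => rfl
      | cons h _ => exact absurd (hadj h).fst_mem hv
    refine hne (SimpleGraph.Subgraph.ext (Set.eq_univ_of_forall hverts) ?_)
    funext u v
    exact propext ⟨fun h => h.adj_sub, hadj⟩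

/-- The preimage in the tree of a subgraph of the quotient graph. -/
def preimage (T : GTree G) (Z : T.quotientGraph.Sub) : T.graph.Subgraph where
  verts := {v | Quotient.mk T.vertexSetoid v ∈ Z.verts}
  Adj u v := ∃ h : T.graph.Adj u v, Quotient.mk T.dartSetoid ⟨(u, v), h⟩ ∈ Z.edges
  adj_sub := fun h => h.1
  edge_vert := fun h => Z.ini_mem _ h.2
  symm := ⟨fun _ _ ⟨h, hZ⟩ => ⟨h.symm, Z.inv_mem _ hZ⟩⟩

theorem preimage_invariant (Z : T.quotientGraph.Sub) : T.Invariant (T.preimage Z) := by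
  refine ⟨fun v hv g => ?_, fun u v ⟨h, hZ⟩ g => ⟨T.act_adj _ _ g h, ?_⟩⟩
  · have : Quotient.mk T.vertexSetoid (T.act v g) = Quotient.mk T.vertexSetoid v :=
      (Quotient.sound (s := T.vertexSetoid) ⟨g, rfl⟩).symm
    change _ ∈ Z.verts
    rw [this]
    exact hv
  · have : Quotient.mk T.dartSetoid ⟨(T.act u g, T.act v g), T.act_adj _ _ g h⟩ =
        Quotient.mk T.dartSetoid ⟨(u, v), h⟩ :=
      (Quotient.sound (s := T.dartSetoid) ⟨g, rfl, rfl⟩).symm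
    rw [this]
    exact hZ

theorem preimage_ne_top {Z : T.quotientGraph.Sub} (hZ : Z.IsProper) : T.preimage Z ≠ ⊤ := by
  intro h
  refine hZ ⟨Set.eq_univ_of_forall fun q => ?_, Set.eq_univ_of_forall fun e => ?_⟩
  · induction q using Quotient.inductionOn with
    | h v =>
      have : v ∈ (T.preimage Z).verts := by rw [h]; trivial
      exact this
  · induction e using Quotient.inductionOn with
    | h d =>
      have : (T.preimage Z).Adj d.fst d.snd := by rw [h]; exact d.adj
      exact this.2

theorem actPoint_mem_carrier {F : T.graph.Subgraph} (hF : T.Invariant F) {x : T.Point}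
    (hx : x ∈ MetricTree.carrier F) (g : G) : T.actPoint x g ∈ MetricTree.carrier F := by
  rcases hx with ⟨v, hv, rfl⟩ | ⟨u, v, huv, hx⟩
  · exact Or.inl ⟨_, hF.1 v hv g, actPoint_vertexPoint v g⟩
  · refine Or.inr ⟨_, _, hF.2 u v huv g, fun w hw => ?_⟩
    exact (hx _ hw).imp (T.act_inv_eq_iff _ _ _).1 (T.act_inv_eq_iff _ _ _).1

theorem mem_carrier_preimage_iff {Z : T.quotientGraph.Sub} {x : T.Point} :
    x ∈ MetricTree.carrier (T.preimage Z) ↔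
      Quotient.mk T.pointSetoid x ∈ T.quotientCarrier Z := by
  constructor
  · rintro (⟨v, hv, rfl⟩ | ⟨u, v, ⟨h, hZ⟩, hx⟩)
    · exact ⟨_, rfl, Or.inl ⟨v, hv, rfl⟩⟩
    · exact ⟨_, rfl, Or.inr ⟨⟨(u, v), h⟩, hZ, hx⟩⟩
  · rintro ⟨y, hy, hyZ⟩
    obtain ⟨g, rfl⟩ := Quotient.exact (s := T.pointSetoid) hy
    refine actPoint_mem_carrier (preimage_invariant Z) ?_ g
    rcases hyZ with ⟨v, hv, rfl⟩ | ⟨d, hd, hx⟩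
    · exact Or.inl ⟨v, hv, rfl⟩
    · exact Or.inr ⟨d.fst, d.snd, ⟨d.adj, hd⟩, hx⟩

theorem mapsTo_preimage {Z : T.quotientGraph.Sub} {a : MulAut G}
    {f : T.Point → (T.twist a).Point}
    (hf : ∀ x g, f (T.actPoint x g) = (T.twist a).actPoint (f x) g)
    (hZ : Set.MapsTo (T.inducedMap a f hf) (T.quotientCarrier Z) (T.quotientCarrier Z)) :
    Set.MapsTo f (MetricTree.carrier (T.preimage Z)) (MetricTree.carrier (T.preimage Z)) :=
  fun _ hx => mem_carrier_preimage_iff.2 (hZ (mem_carrier_preimage_iff.1 hx))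

/-- A path in the graph of groups on `Z` lifts to the preimage of `Z`. -/
theorem QuotientGraphOfGroups.PathElt.reachable {X : T.QuotientGraphOfGroups}
    {Z : T.quotientGraph.Sub} {v w : T.quotientGraph.V} {x : G} (h : X.PathElt Z v w x) :
    (T.preimage Z).spanningCoe.Reachable (X.lift v) (T.act (X.lift w) x⁻¹) := by
  induction h with
  | base g hg =>
    rw [mem_stab.1 (inv_mem hg)]
  | step e x g h he hg ih =>
    refine ih.trans (SimpleGraph.Adj.reachable ?_)
    obtain ⟨d, hd, h1, h2⟩ := X.lift_edge e
    have hadj : (T.preimage Z).Adj (T.act d.fst x⁻¹) (T.act d.snd x⁻¹) :=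
      (preimage_invariant Z).2 _ _ ⟨d.adj, by rw [← hd] at he; exact he⟩ _
    have h3 : T.act (X.lift (T.quotientGraph.ter e)) (x * X.elt e * g)⁻¹ = T.act d.snd x⁻¹ := by
      rw [mul_inv_rev, mul_inv_rev, T.act_mul, mem_stab.1 (inv_mem hg), T.act_mul, h2]
    rw [h3, ← h1]
    exact hadj

/-- The fundamental group of a component lies in the stabiliser of a lifted component, and elliptic
subgroups are closed under passing to subgroups; this inclusion suffices. -/
theorem preimage_forestHyperbolic {X : T.QuotientGraphOfGroups} {Z : T.quotientGraph.Sub}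
    (h : X.SubgraphHyperbolic T.ellipticSubgroups Z) :
    T.ForestHyperbolic T.ellipticSubgroups (T.preimage Z) := by
  intro hell
  refine h fun v hv => ?_
  have hlift : X.lift v ∈ (T.preimage Z).verts := by
    change _ ∈ Z.verts
    rw [X.mk_lift]
    exact hv
  refine mem_ellipticSubgroups_of_le ?_ (hell ((T.preimage Z).coe.connectedComponentMk
    ⟨_, hlift⟩))
  rw [setStabilizer_componentVerts (preimage_invariant Z), QuotientGraphOfGroups.fundamentalGroup,
    Subgroup.closure_le]
  intro x hx
  -- For the right action, a closed path with element `x` lifts to a path ending at the translate by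
  -- `x⁻¹`.
  rw [SetLike.mem_coe, ← inv_mem_iff, IsInvariantForest.mem_stab_toCollapse]
  exact QuotientGraphOfGroups.PathElt.reachable hx

end GTree

end FreeFactor

theorem mainTheorem5 {G : Type u} [Group G] (𝒢 : Set (Subgroup G))
    (h𝒢 : IsFreeFactorSystem 𝒢) (hproper : IsProper 𝒢)
    (α : Out G) (hα : α ∈ OutPreserving 𝒢)
    (T : GTree G) (hT : T.InDeformationSpace 𝒢)
    (a : MulAut G) (ha : (QuotientGroup.mk a : Out G) = α)
    (f : T.Point → (T.twist a).Point) (hf : T.Represents a f)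
    (hsimp : MetricTree.IsSimplicial f) :
    ((∃ F : T.graph.Subgraph, F ≠ ⊤ ∧
        Set.MapsTo f (MetricTree.carrier F) (MetricTree.carrier F) ∧
        T.Invariant F ∧ T.ForestHyperbolic 𝒢 F) →
      IsReducible 𝒢 α) ∧
    ((∃ (X : T.QuotientGraphOfGroups) (Z : T.quotientGraph.Sub), Z.IsProper ∧
        Set.MapsTo (T.inducedMap a f hf.1.1) (T.quotientCarrier Z) (T.quotientCarrier Z) ∧
        X.SubgraphHyperbolic 𝒢 Z) →
      IsReducible 𝒢 α) := by
  subst ha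
  refine ⟨?_, ?_⟩
  · rintro ⟨F, hne, hmaps, hinv, hhyp⟩
    exact GTree.isReducible_of_subforest hproper hT hα hf hsimp hne hmaps hinv hhyp
  · rintro ⟨X, Z, hZ, hmaps, hhyp⟩
    refine GTree.isReducible_of_subforest hproper hT hα hf hsimp (GTree.preimage_ne_top hZ)
      (GTree.mapsTo_preimage hf.1.1 hmaps) (GTree.preimage_invariant Z) ?_
    obtain ⟨-, -, -, rfl⟩ := hT
    exact GTree.preimage_forestHyperbolic hhyp
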